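/- Let $\ell>0$, $\xi\in(-\ell,\ell)$, $a_+<0<a_-$, and let $a^0$ be the step function equal to $a_-$ on $(-\ell,\xi)$ and to $a_+$ on $(\xi,\ell)$. Let $\varepsilon_0>0$ and let $(a^\varepsilon)_{0<\varepsilon<\varepsilon_0}$ be a family of real Lipschitz functions on $[-\ell,\ell]$ for which there are constants $C_0,C_1>0$, independent of $\varepsilon$, such that for all $\varepsilon\in(0,\varepsilon_0)$ $$|a^\varepsilon|_{L^\infty(-\ell,\ell)}+\varepsilon\left|\frac{da^\varepsilon}{dx}\right|_{L^\infty(-\ell,\ell)}\le C_0,\qquad |a^\varepsilon-a^0|_{L^1(-\ell,\ell)}\le C_1\varepsilon .$$ On the complex space $L^2(-\ell,\ell)$, with domain $H^2(-\ell,\ell)\cap H^1_0(-\ell,\ell)$, consider the operators $$\mathcal L^\varepsilon u=\varepsilon u''-(a^\varepsilon u)',\qquad \mathcal M^\varepsilon v=\varepsilon^2v''-b^\varepsilon v,\qquad b^\varepsilon=\Bigl(\tfrac12a^\varepsilon\Bigr)^2+\tfrac12\,\varepsilon\,\frac{da^\varepsilon}{dx}.$$ Then the following hold. 1. For every $\varepsilon\in(0,\varepsilon_0)$,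 $\mathcal M^\varepsilon$ is self-adjoint and is conjugate to $\varepsilon\mathcal L^\varepsilon$ by the Liouville transform: with $g^\varepsilon(x)=\exp\bigl(-\frac1{2\varepsilon}\int_{-\ell}^x a^\varepsilon(y)\,dy\bigr)$ and $u,f\in L^2(-\ell,\ell)$, one has $u\in D(\mathcal L^\varepsilon)$ and $\mathcal L^\varepsilon u=f$ if and only if $g^\varepsilon u\in D(\mathcal M^\varepsilon)$ and $\mathcal M^\varepsilon(g^\varepsilon u)=\varepsilon g^\varepsilon f$. The spectrum of $\mathcal L^\varepsilon$ consists of eigenvalues, all of them real and negative. 2. There are constants $C,c>0$, independent of $\varepsilon$, such that for every $\varepsilon\in(0,\varepsilon_0)$ the operator $\mathcal L^\varepsilon$ has a first (that is, largest) eigenvalue $\lambda_1^\varepsilon$, and $$-C\,e^{-c/\varepsilon}\le\lambda_1^\varepsilon<0 .$$ -/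

import Mathlib

open MeasureTheory Set
open scoped ENNReal

noncomputable section

namespace DiffusionTransport

/-- Lebesgue measure on the interval `(-ℓ, ℓ)`. -/
abbrev intervalMeasure (ℓ : ℝ) : Measure ℝ := volume.restrict (Ioo (-ℓ) ℓ)

/-- The complex Hilbert space `L²(-ℓ, ℓ)`. -/
abbrev L2 (ℓ : ℝ) : Type := Lp ℂ 2 (intervalMeasure ℓ)

/-- `u` belongs to `H²(-ℓ, ℓ) ∩ H¹₀(-ℓ, ℓ)`, with derivative `u'` and second derivative `u''`:
`u` is differentiable on `[-ℓ, ℓ]`, its derivative `u'` is absolutely continuous, the almost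
everywhere derivative `u''` of `u'` is square integrable, and `u` vanishes at `±ℓ`. -/
structure IsDirichletH2 (ℓ : ℝ) (u u' u'' : ℝ → ℂ) : Prop where
  hasDeriv : ∀ x ∈ Icc (-ℓ) ℓ, HasDerivWithinAt u (u' x) (Icc (-ℓ) ℓ) x
  absCont : AbsolutelyContinuousOnInterval u' (-ℓ) ℓ
  hasSecondDeriv : ∀ᵐ x ∂(intervalMeasure ℓ), HasDerivAt u' (u'' x) x
  memLp : MemLp u'' 2 (intervalMeasure ℓ)
  left : u (-ℓ) = 0
  right : u ℓ = 0

/-- The graph of the operator `𝓛 u = ε u'' - (a u)'` in `L²(-ℓ, ℓ)` with domain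
`H²(-ℓ, ℓ) ∩ H¹₀(-ℓ, ℓ)`: `transportOp ℓ ε a U F` means that `U` is in the domain and
`𝓛 U = F`. -/
def transportOp (ℓ ε : ℝ) (a : ℝ → ℝ) (U F : L2 ℓ) : Prop :=
  ∃ u u' u'' : ℝ → ℂ, IsDirichletH2 ℓ u u' u'' ∧
    U =ᵐ[intervalMeasure ℓ] u ∧
    F =ᵐ[intervalMeasure ℓ] fun x => (ε : ℂ) * u'' x - deriv (fun y => (a y : ℂ) * u y) x

/-- The potential `b = (a / 2)² + (ε / 2) a'`. -/
def potential (ε : ℝ) (a : ℝ → ℝ) (x : ℝ) : ℝ := (a x / 2) ^ 2 + ε / 2 * deriv a x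

/-- The graph of the Schrödinger operator `𝓜 v = ε² v'' - b v` in `L²(-ℓ, ℓ)` with domain
`H²(-ℓ, ℓ) ∩ H¹₀(-ℓ, ℓ)`. -/
def schrodingerOp (ℓ ε : ℝ) (a : ℝ → ℝ) (V G : L2 ℓ) : Prop :=
  ∃ v v' v'' : ℝ → ℂ, IsDirichletH2 ℓ v v' v'' ∧
    V =ᵐ[intervalMeasure ℓ] v ∧
    G =ᵐ[intervalMeasure ℓ] fun x => (ε : ℂ) ^ 2 * v'' x - (potential ε a x : ℂ) * v x

/-- The Liouville factor `exp (-(1 / 2ε) ∫_{-ℓ}^x a)`. -/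
def liouvilleFactor (ℓ ε : ℝ) (a : ℝ → ℝ) (x : ℝ) : ℝ :=
  Real.exp (-(1 / (2 * ε)) * ∫ y in (-ℓ)..x, a y)

/-- The step function equal to `am` to the left of `ξ` and to `ap` to its right. -/
def stepFun (ξ am ap : ℝ) (x : ℝ) : ℝ := if x < ξ then am else ap

section Operators

variable {H : Type*} [NormedAddCommGroup H] [InnerProductSpace ℂ H]

/-- `z` is an eigenvalue of the (unbounded) operator with graph `T`. -/
def IsEigenvalue (T : H → H → Prop) (z : ℂ) : Prop := ∃ U : H, U ≠ 0 ∧ T U (z • U)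

/-- The spectrum of the (unbounded) operator with graph `T`: the complement of the set of `z` for
which `T - z` is a bijection of the domain of `T` onto `H` with a bounded inverse `R`. -/
def opSpectrum (T : H → H → Prop) : Set ℂ :=
  {z | ¬ ∃ R : H →L[ℂ] H, ∀ U F : H, T U (F + z • U) ↔ U = R F}

/-- The (unbounded) operator with graph `T` is densely defined and equal to its adjoint. -/
def IsSelfAdjointOp (T : H → H → Prop) : Prop :=
  Dense {U : H | ∃ F, T U F} ∧
    ∀ V G : H, T V G ↔ ∀ U F : H, T U F → inner ℂ V F = inner ℂ G U

end Operators

end DiffusionTransport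

end

noncomputable section

namespace DiffusionTransport

/-! ### Absolutely continuous complex-valued functions. -/

section AbsolutelyContinuous

/-! Write `A` for the primitive of `a` vanishing at `-ℓ`. Everything rests on the factorization `𝓜 =
(ε d/dx + a/2)(ε d/dx - a/2)`, which is what the choice of `b` encodes, and on `𝓜` being the
conjugate of `ε𝓛` by `e^{-A/2ε}`.

Inverses. The equation `𝓛 u = f` integrates once to `ε u' - a u = ∫ f - c`, and a second time with
the integrating factor `e^{-A/ε}`; the condition `u(ℓ) = 0` fixes `c`. So `𝓛` has an inverse built
from two Volterra operators, multiplications and a rank-one correction (`exists_transport_inverse`).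
It is compact because the Volterra operator is, and conjugation carries it to a compact inverse `S`
of `𝓜`. By the Fredholm alternative the spectrum of `𝓛` consists of eigenvalues.

Signs. The factorization gives `⟨v, 𝓜 v⟩ = -∫ |ε v' - a v / 2|² ≤ 0` (`inner_schrodingerOp_nonpos`).
Hence `S` is symmetric, `𝓜` is self-adjoint, and its eigenvalues, which are `ε` times those of `𝓛`,
are real and negative, zero being excluded by invertibility.

First eigenvalue. A compact self-adjoint `S` has an eigenvalue of modulus `‖S‖`, so the largest
eigenvalue `μ` of `𝓜` satisfies `-μ = 1 / ‖S‖`, and `-μ ‖V‖ ≤ ‖𝓜 V‖` for each `V` in the domain. It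
remains to find one good trial function (`exists_quasimode`). The function `e^{A/2ε}` is annihilated
by `ε d/dx - a/2` but violates the boundary conditions. Since `a` is `L¹`-close to a step going from
positive to negative at `ξ`, `A` is, up to `O(ε)`, maximal at `ξ` with linear decay on both sides.
Multiplying by a cutoff `χ` equal to 1 near `ξ` leaves the error `e^{A/2ε}(ε² χ'' + ε a χ')`,
supported away from `ξ`, hence exponentially small relative to `‖V‖`. -/

theorem _root_.LipschitzWith.comp_absolutelyContinuousOnInterval {X Y : Type*}
    [PseudoMetricSpace X] [PseudoMetricSpace Y] {K : NNReal} {φ : X → Y} (hφ : LipschitzWith K φ)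
    {f : ℝ → X} {a b : ℝ} (hf : AbsolutelyContinuousOnInterval f a b) :
    AbsolutelyContinuousOnInterval (fun x => φ (f x)) a b := by
  apply squeeze_zero (fun t ↦ ?_) (fun t ↦ ?_) (by simpa using Filter.Tendsto.const_mul (K : ℝ) hf)
  · exact Finset.sum_nonneg (fun i hi ↦ by positivity)
  · rw [Finset.mul_sum]
    exact Finset.sum_le_sum fun i _ => hφ.dist_le_mul _ _

theorem absolutelyContinuousOnInterval_intervalIntegral_complex {f : ℝ → ℂ} {a b c : ℝ}
    (h : IntervalIntegrable f volume a b) (hc : c ∈ uIcc a b) :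
    AbsolutelyContinuousOnInterval (fun x ↦ ∫ v in c..x, f v) a b := by
  have hre : IntervalIntegrable (fun x => (f x).re) volume a b :=
    ⟨Complex.reCLM.integrable_comp h.1, Complex.reCLM.integrable_comp h.2⟩
  have him : IntervalIntegrable (fun x => (f x).im) volume a b :=
    ⟨Complex.imCLM.integrable_comp h.1, Complex.imCLM.integrable_comp h.2⟩
  have h1 := Complex.ofRealCLM.lipschitz.comp_absolutelyContinuousOnInterval
    (hre.absolutelyContinuousOnInterval_intervalIntegral hc)
  have h2 := (Complex.ofRealCLM.lipschitz.comp_absolutelyContinuousOnInterval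
    (him.absolutelyContinuousOnInterval_intervalIntegral hc)).const_smul Complex.I
  have h3 := h1.fun_add h2
  -- The splitting into real and imaginary parts is known only on `uIcc a b`, where `f` is
  -- integrable, so the transfer goes through the ε-δ form, whose endpoints all lie there.
  refine ((absolutelyContinuousOnInterval_iff _ _ _).2 fun ε hε => ?_)
  obtain ⟨δ, hδ, H⟩ := (absolutelyContinuousOnInterval_iff _ _ _).1 h3 ε hε
  have key : ∀ x ∈ uIcc a b, (∫ v in c..x, f v) =
      Complex.ofRealCLM (∫ v in c..x, (f v).re) +
        Complex.I • Complex.ofRealCLM (∫ v in c..x, (f v).im) := by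
    intro x hx
    have hcx : IntervalIntegrable f volume c x := h.mono_set (uIcc_subset_uIcc hc hx)
    have e1 := Complex.reCLM.intervalIntegral_comp_comm hcx
    have e2 := Complex.imCLM.intervalIntegral_comp_comm hcx
    simp only [Complex.reCLM_apply, Complex.imCLM_apply] at e1 e2
    rw [e1, e2]
    apply Complex.ext <;> simp
  refine ⟨δ, hδ, fun E hE hlen => ?_⟩
  convert H E hE hlen using 1
  refine Finset.sum_congr rfl fun i hi => ?_
  have := hE.1 i hi
  rw [key _ this.1, key _ this.2]

/-- Fundamental theorem of calculus for a complex valued absolutely continuous function. -/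
theorem intervalIntegrable_and_integral_of_absolutelyContinuous {f f' : ℝ → ℂ} {a b : ℝ}
    (hab : a ≤ b) (hf : AbsolutelyContinuousOnInterval f a b)
    (hf' : ∀ᵐ x ∂(volume.restrict (Ioo a b)), HasDerivAt f (f' x) x) :
    IntervalIntegrable f' volume a b ∧ ∀ x ∈ Icc a b, ∫ t in a..x, f' t = f x - f a := by
  have hre : AbsolutelyContinuousOnInterval (fun x => (f x).re) a b :=
    Complex.reCLM.lipschitz.comp_absolutelyContinuousOnInterval hf
  have him : AbsolutelyContinuousOnInterval (fun x => (f x).im) a b :=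
    Complex.imCLM.lipschitz.comp_absolutelyContinuousOnInterval hf
  have dre : ∀ᵐ x ∂(volume.restrict (Ioc a b)), deriv (fun x => (f x).re) x = (f' x).re := by
    rw [← restrict_Ioo_eq_restrict_Ioc]
    filter_upwards [hf'] with x hx
    exact (Complex.reCLM.hasFDerivAt.comp_hasDerivAt x hx).deriv
  have dim : ∀ᵐ x ∂(volume.restrict (Ioc a b)), deriv (fun x => (f x).im) x = (f' x).im := by
    rw [← restrict_Ioo_eq_restrict_Ioc]
    filter_upwards [hf'] with x hx
    exact (Complex.imCLM.hasFDerivAt.comp_hasDerivAt x hx).deriv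
  have ire : IntervalIntegrable (fun x => (f' x).re) volume a b := by
    have := hre.intervalIntegrable_deriv
    rw [intervalIntegrable_iff_integrableOn_Ioc_of_le hab] at this ⊢
    exact this.congr dre
  have iim : IntervalIntegrable (fun x => (f' x).im) volume a b := by
    have := him.intervalIntegrable_deriv
    rw [intervalIntegrable_iff_integrableOn_Ioc_of_le hab] at this ⊢
    exact this.congr dim
  have hint : IntervalIntegrable f' volume a b := by
    have h1 : IntervalIntegrable (fun x => ((f' x).re : ℂ)) volume a b :=
      ⟨Complex.ofRealCLM.integrable_comp ire.1, Complex.ofRealCLM.integrable_comp ire.2⟩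
    have h2 : IntervalIntegrable (fun x => ((f' x).im : ℂ)) volume a b :=
      ⟨Complex.ofRealCLM.integrable_comp iim.1, Complex.ofRealCLM.integrable_comp iim.2⟩
    have := h1.add (h2.mul_const Complex.I)
    simpa only [Complex.re_add_im] using this
  refine ⟨hint, fun x hx => ?_⟩
  have hsub : uIcc a x ⊆ uIcc a b := by
    rw [uIcc_of_le hx.1, uIcc_of_le hab]; exact Icc_subset_Icc_right hx.2
  have hax := hint.mono_set hsub
  have e1 := Complex.reCLM.intervalIntegral_comp_comm hax
  have e2 := Complex.imCLM.intervalIntegral_comp_comm hax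
  simp only [Complex.reCLM_apply, Complex.imCLM_apply] at e1 e2
  have hle : volume.restrict (Ioc a x) ≤ volume.restrict (Ioc a b) :=
    Measure.restrict_mono (Ioc_subset_Ioc_right hx.2) le_rfl
  have c1 : ∫ t in a..x, (f' t).re = ∫ t in a..x, deriv (fun x => (f x).re) t := by
    rw [intervalIntegral.integral_of_le hx.1, intervalIntegral.integral_of_le hx.1]
    exact integral_congr_ae (Filter.EventuallyEq.symm (ae_mono hle dre))
  have c2 : ∫ t in a..x, (f' t).im = ∫ t in a..x, deriv (fun x => (f x).im) t := by
    rw [intervalIntegral.integral_of_le hx.1, intervalIntegral.integral_of_le hx.1]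
    exact integral_congr_ae (Filter.EventuallyEq.symm (ae_mono hle dim))
  rw [(hre.mono hsub).integral_deriv_eq_sub, e1] at c1
  rw [(him.mono hsub).integral_deriv_eq_sub, e2] at c2
  exact Complex.ext (by simpa using c1) (by simpa using c2)

end AbsolutelyContinuous

/-! ### Unbounded operators given by a bounded or compact inverse. -/

section Abstract

variable {H : Type*} [NormedAddCommGroup H] [InnerProductSpace ℂ H] {T : H → H → Prop}

/-- Fredholm alternative: for `z ≠ 0`, `(T - z) U = F` is equivalent to `(z⁻¹ - K) U = z⁻¹ K F`, and
for compact `K` the operator `z⁻¹ - K` is invertible unless `z⁻¹` is an eigenvalue of `K`, i.e. `z`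
one of `T`. -/
theorem isEigenvalue_of_mem_opSpectrum [CompleteSpace H] {K : H →L[ℂ] H} (hK : IsCompactOperator K)
    (hT : ∀ U F, T U F ↔ U = K F) {z : ℂ} (hz : z ∈ opSpectrum T) : IsEigenvalue T z := by
  by_contra hne
  refine hz ?_
  rcases eq_or_ne z 0 with rfl | hz0
  · exact ⟨K, fun U F => by simp [hT]⟩
  have hev : ¬ Module.End.HasEigenvalue (K : Module.End ℂ H) z⁻¹ := by
    intro h
    obtain ⟨U, hU⟩ := h.exists_hasEigenvector
    refine hne ⟨U, hU.2, (hT _ _).2 ?_⟩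
    have : K U = z⁻¹ • U := hU.apply_eq_smul
    rw [map_smul, this, smul_smul, mul_inv_cancel₀ hz0, one_smul]
  rw [hK.hasEigenvalue_iff_mem_spectrum (inv_ne_zero hz0), spectrum.notMem_iff] at hev
  obtain ⟨B, hB⟩ := hev
  have hBv : ∀ U, (B : H →L[ℂ] H) U = z⁻¹ • U - K U := fun U => by
    rw [hB]; simp [Algebra.algebraMap_eq_smul_one]
  refine ⟨(↑B⁻¹ : H →L[ℂ] H).comp (z⁻¹ • K), fun U F => ?_⟩
  have e1 : ∀ W, (↑B⁻¹ : H →L[ℂ] H) ((B : H →L[ℂ] H) W) = W := fun W => by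
    rw [← mul_apply_eq_comp]; simp
  have e2 : ∀ W, (B : H →L[ℂ] H) ((↑B⁻¹ : H →L[ℂ] H) W) = W := fun W => by
    rw [← mul_apply_eq_comp]; simp
  rw [hT, map_add, map_smul]
  constructor
  · intro h
    have h' : (B : H →L[ℂ] H) U = z⁻¹ • K F := by
      rw [hBv, sub_eq_iff_eq_add]
      have := congrArg (fun W => z⁻¹ • W) h
      simpa [smul_add, smul_smul, hz0] using this
    rw [ContinuousLinearMap.comp_apply, smul_apply, ← h', e1]
  · intro h
    have h' : (B : H →L[ℂ] H) U = z⁻¹ • K F := by rw [h]; simp [e2]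
    rw [hBv, sub_eq_iff_eq_add] at h'
    have := congrArg (fun W => z • W) h'
    simpa [smul_smul, hz0] using this

/-- For an eigenvector, `⟨U, zU⟩ = z ‖U‖²` is real and nonpositive; `z = 0` would give `U = S 0 =
0`. -/
theorem eigenvalue_real_neg {S : H →L[ℂ] H} (hT : ∀ U F, T U F ↔ U = S F)
    (hneg : ∀ V G, T V G → ∃ r : ℝ, r ≤ 0 ∧ inner ℂ V G = r) {z : ℂ} (hz : IsEigenvalue T z) :
    z.im = 0 ∧ z.re < 0 := by
  obtain ⟨U, hU, hTU⟩ := hz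
  obtain ⟨r, hr, h⟩ := hneg _ _ hTU
  rw [inner_smul_right, inner_self_eq_norm_sq_to_K] at h
  have hpos : 0 < ‖U‖ ^ 2 := by positivity
  have h2 : z = ((r / ‖U‖ ^ 2 : ℝ) : ℂ) := by
    have : (‖U‖ : ℂ) ≠ 0 := by exact_mod_cast norm_ne_zero_iff.2 hU
    push_cast
    rw [eq_div_iff (by positivity)]
    exact h
  have hz0 : z ≠ 0 := by
    rintro rfl
    apply hU
    simpa using (hT _ _).1 hTU
  rw [h2] at hz0 ⊢
  refine ⟨Complex.ofReal_im _, ?_⟩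
  rw [Complex.ofReal_re]
  exact lt_of_le_of_ne (div_nonpos_of_nonpos_of_nonneg hr hpos.le) fun h => hz0 (by simp [h])

theorem isSymmetric_of_inner_nonpos {S : H →L[ℂ] H} (hT : ∀ U F, T U F ↔ U = S F)
    (hneg : ∀ V G, T V G → ∃ r : ℝ, r ≤ 0 ∧ inner ℂ V G = r) :
    (S : H →ₗ[ℂ] H).IsSymmetric := by
  rw [LinearMap.isSymmetric_iff_inner_map_self_real]
  intro G
  obtain ⟨r, -, h⟩ := hneg (S G) G ((hT _ _).2 rfl)
  simp only [ContinuousLinearMap.coe_coe]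
  rw [h, Complex.conj_ofReal]

/-- The domain is the range of the symmetric operator `S`, whose orthogonal complement is `ker S`;
this is trivial because `T` is single-valued at 0. Equality with the adjoint follows by testing
against `U = S F` for every `F`. -/
theorem isSelfAdjointOp_of_inverse [CompleteSpace H] {S : H →L[ℂ] H}
    (hT : ∀ U F, T U F ↔ U = S F)
    (hneg : ∀ V G, T V G → ∃ r : ℝ, r ≤ 0 ∧ inner ℂ V G = r) (h0 : ∀ G, T 0 G → G = 0) :
    IsSelfAdjointOp T := by
  have hS := isSymmetric_of_inner_nonpos hT hneg
  have hS' : ∀ x y, inner ℂ (S x) y = inner ℂ x (S y) := hS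
  constructor
  · have : {U : H | ∃ F, T U F} = (S.range : Set H) := by
      ext U; simp [hT, eq_comm]
    rw [this, Submodule.dense_iff_topologicalClosure_eq_top,
      Submodule.topologicalClosure_eq_top_iff, Submodule.eq_bot_iff]
    intro G hG
    refine h0 G ((hT _ _).2 ?_)
    symm
    rw [← inner_self_eq_zero (𝕜 := ℂ), hS']
    rw [Submodule.mem_orthogonal'] at hG
    exact hG _ ⟨S G, rfl⟩
  · intro V G
    rw [hT]
    constructor
    · rintro rfl U F hUF
      rw [(hT _ _).1 hUF, hS']
    · intro h
      refine ext_inner_right ℂ fun F => ?_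
      rw [h (S F) F ((hT _ _).2 rfl), hS']

/-- Self-adjointness makes the spectral radius of `S` equal to `‖S‖`, and compactness makes a
spectral point `k` of that modulus an eigenvalue. Then `μ = k⁻¹` has `-μ = ‖S‖⁻¹`. The final
inequality is `‖S G‖ ≤ ‖S‖ ‖G‖` read backwards; applied to eigenvectors it gives the maximality of
`μ`, and applied to a trial function it bounds `μ` from below. -/
theorem exists_first_eigenvalue [CompleteSpace H] [Nontrivial H] {S : H →L[ℂ] H}
    (hc : IsCompactOperator S) (hT : ∀ U F, T U F ↔ U = S F)
    (hneg : ∀ V G, T V G → ∃ r : ℝ, r ≤ 0 ∧ inner ℂ V G = r) (h0 : ∀ G, T 0 G → G = 0) :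
    ∃ μ : ℝ, IsGreatest {lam : ℝ | IsEigenvalue T (lam : ℂ)} μ ∧ μ < 0 ∧
      ∀ V G, T V G → -μ * ‖V‖ ≤ ‖G‖ := by
  have hS := isSymmetric_of_inner_nonpos hT hneg
  have hsa : IsSelfAdjoint S := (ContinuousLinearMap.isSelfAdjoint_iff_isSymmetric).2 hS
  have hS0 : S ≠ 0 := by
    rintro rfl
    obtain ⟨G, hG⟩ := exists_ne (0 : H)
    exact hG (h0 G ((hT _ _).2 (by simp)))
  have hn : 0 < ‖S‖ := norm_pos_iff.2 hS0
  obtain ⟨k, hk, hk2⟩ := spectrum.exists_nnnorm_eq_spectralRadius S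
  rw [hsa.spectralRadius_eq_nnnorm] at hk2
  have hk3 : ‖k‖ = ‖S‖ := by exact_mod_cast congrArg ENNReal.toReal hk2
  have hk0 : k ≠ 0 := by rw [← norm_pos_iff, hk3]; exact hn
  have hev := (hc.hasEigenvalue_iff_mem_spectrum hk0).2 hk
  obtain ⟨U, hU⟩ := hev.exists_hasEigenvector
  have hSU : S U = k • U := hU.apply_eq_smul
  have hkT : IsEigenvalue T k⁻¹ :=
    ⟨U, hU.2, (hT _ _).2 (by rw [map_smul, hSU, smul_smul, inv_mul_cancel₀ hk0, one_smul])⟩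
  obtain ⟨him, hre⟩ := eigenvalue_real_neg hT hneg hkT
  have hkk : k⁻¹ = ((k⁻¹).re : ℂ) := Complex.ext (by simp) (by simpa using him)
  have habs : -(k⁻¹).re = ‖S‖⁻¹ := by
    rw [← hk3, ← norm_inv, ← abs_of_neg hre]
    conv_rhs => rw [hkk]
    rw [Complex.norm_real, Real.norm_eq_abs]
  have hbound : ∀ V G, T V G → -(k⁻¹).re * ‖V‖ ≤ ‖G‖ := by
    intro V G h
    rw [habs, (hT _ _).1 h, inv_mul_le_iff₀ hn]
    exact S.le_opNorm G
  refine ⟨(k⁻¹).re, ⟨?_, ?_⟩, hre, hbound⟩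
  · rw [mem_ofPred_eq, ← hkk]; exact hkT
  · intro lam hlam
    have hlneg := (eigenvalue_real_neg hT hneg hlam).2
    rw [Complex.ofReal_re] at hlneg
    obtain ⟨V, hV, hTV⟩ := hlam
    have := hbound _ _ hTV
    rw [norm_smul, Complex.norm_real, Real.norm_eq_abs, abs_of_neg hlneg] at this
    have := le_of_mul_le_mul_right this (norm_pos_iff.2 hV)
    linarith

end Abstract

/-! ### Volterra and multiplication operators on `L²(-ℓ, ℓ)`. -/

section Operators

variable {ℓ : ℝ}

theorem intervalIntegrable_of_integrable {E : Type*} [NormedAddCommGroup E] (hℓ : 0 < ℓ)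
    {f : ℝ → E} (hf : Integrable f (intervalMeasure ℓ)) {x y : ℝ} (hx : x ∈ Icc (-ℓ) ℓ)
    (hy : y ∈ Icc (-ℓ) ℓ) : IntervalIntegrable f volume x y := by
  have h : IntervalIntegrable f volume (-ℓ) ℓ := by
    rw [intervalIntegrable_iff_integrableOn_Ioo_of_le (by linarith)]
    exact hf
  refine h.mono_set (uIcc_subset_uIcc ?_ ?_) <;> rwa [uIcc_of_le (by linarith)]

theorem L2.intervalIntegrable (hℓ : 0 < ℓ) (F : L2 ℓ) {x y : ℝ} (hx : x ∈ Icc (-ℓ) ℓ)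
    (hy : y ∈ Icc (-ℓ) ℓ) : IntervalIntegrable F volume x y :=
  intervalIntegrable_of_integrable hℓ ((Lp.memLp F).integrable (by norm_num)) hx hy

theorem intervalIntegral_eq_integral_interval (hℓ : 0 < ℓ) (f : ℝ → ℂ) :
    ∫ x in (-ℓ)..ℓ, f x = ∫ x, f x ∂(intervalMeasure ℓ) := by
  rw [intervalIntegral.integral_of_le (by linarith), integral_Ioc_eq_integral_Ioo]

theorem intervalIntegral_congr_of_ae {f g : ℝ → ℂ} (h : f =ᵐ[intervalMeasure ℓ] g) {x y : ℝ}
    (hx : -ℓ ≤ x) (hy : y ≤ ℓ) (hxy : x ≤ y) : ∫ t in x..y, f t = ∫ t in x..y, g t := by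
  rw [intervalIntegral.integral_of_le hxy, intervalIntegral.integral_of_le hxy,
    integral_Ioc_eq_integral_Ioo, integral_Ioc_eq_integral_Ioo]
  exact integral_congr_ae (ae_mono (Measure.restrict_mono (Ioo_subset_Ioo hx hy) le_rfl) h)

/-- Cauchy–Schwarz against the indicator of the interval between `x` and `y`. -/
theorem L2.norm_intervalIntegral_le (F : L2 ℓ) {x y : ℝ} (hx : x ∈ Icc (-ℓ) ℓ)
    (hy : y ∈ Icc (-ℓ) ℓ) : ‖∫ t in x..y, F t‖ ≤ √|x - y| * ‖F‖ := by
  wlog hxy : x ≤ y generalizing x y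
  · rw [intervalIntegral.integral_symm, norm_neg, abs_sub_comm]
    exact this hy hx (le_of_not_ge hxy)
  have hfin : intervalMeasure ℓ (Ioo x y) ≠ ⊤ := measure_ne_top _ _
  have hrr : (intervalMeasure ℓ).restrict (Ioo x y) = volume.restrict (Ioo x y) := by
    rw [Measure.restrict_restrict measurableSet_Ioo,
      inter_eq_left.2 (Ioo_subset_Ioo hx.1 hy.2)]
  have hμ : (intervalMeasure ℓ).real (Ioo x y) = y - x := by
    have := congrArg (fun m => Measure.real m univ) hrr
    simp only [measureReal_restrict_apply_univ] at this
    rw [this]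
    simp [hxy]
  have h := L2.inner_indicatorConstLp_one (𝕜 := ℂ) measurableSet_Ioo hfin F
  rw [hrr, ← integral_Ioc_eq_integral_Ioo, ← intervalIntegral.integral_of_le hxy] at h
  rw [← h]
  refine (norm_inner_le_norm _ _).trans (le_of_eq ?_)
  rw [norm_indicatorConstLp (by norm_num) (by norm_num), hμ, abs_sub_comm,
    abs_of_nonneg (sub_nonneg.2 hxy), Real.sqrt_eq_rpow]
  norm_num

/-- The primitive vanishing at `-ℓ` of an element of `L²(-ℓ, ℓ)`, as a continuous function. -/
def primitiveFun (hℓ : 0 < ℓ) (F : L2 ℓ) : BoundedContinuousFunction (Icc (-ℓ) ℓ) ℂ :=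
  BoundedContinuousFunction.mkOfCompact ⟨fun x => ∫ t in (-ℓ)..x, F t, by
    have h : ContinuousOn (fun x => ∫ t in (-ℓ)..x, F t) (Icc (-ℓ) ℓ) := by
      have hi : IntegrableOn F (uIcc (-ℓ) ℓ) := by
        have := F.intervalIntegrable hℓ (left_mem_Icc.2 (by linarith))
          (right_mem_Icc.2 (by linarith))
        rwa [intervalIntegrable_iff'] at this
      have := intervalIntegral.continuousOn_primitive_interval hi
      rwa [uIcc_of_le (by linarith)] at this
    exact continuousOn_iff_continuous_domRestrict.1 h⟩

@[simp]
theorem primitiveFun_apply (hℓ : 0 < ℓ) (F : L2 ℓ) (x : Icc (-ℓ) ℓ) :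
    primitiveFun hℓ F x = ∫ t in (-ℓ)..x, F t := rfl

/-- Restriction to `(-ℓ, ℓ)` of a continuous function on `[-ℓ, ℓ]`, as an element of `L²`. -/
def restrictL2 (hℓ : 0 < ℓ) (f : BoundedContinuousFunction (Icc (-ℓ) ℓ) ℂ) : L2 ℓ :=
  BoundedContinuousFunction.toLp 2 (intervalMeasure ℓ) ℂ
    (f.compContinuous ⟨projIcc (-ℓ) ℓ (by linarith), continuous_projIcc⟩)

theorem continuous_restrictL2 (hℓ : 0 < ℓ) : Continuous (restrictL2 hℓ) :=
  (ContinuousLinearMap.continuous _).comp (BoundedContinuousFunction.continuous_compContinuous _)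

theorem restrictL2_primitiveFun_ae (hℓ : 0 < ℓ) (F : L2 ℓ) :
    restrictL2 hℓ (primitiveFun hℓ F) =ᵐ[intervalMeasure ℓ] fun x => ∫ t in (-ℓ)..x, F t := by
  filter_upwards [BoundedContinuousFunction.coeFn_toLp 2 (intervalMeasure ℓ) ℂ
    ((primitiveFun hℓ F).compContinuous ⟨projIcc (-ℓ) ℓ (by linarith), continuous_projIcc⟩),
    ae_restrict_mem measurableSet_Ioo] with x hx hm
  refine hx.trans ?_
  simp [projIcc_of_mem _ (Ioo_subset_Icc_self hm)]

/-- The Volterra operator on `L²(-ℓ, ℓ)`. -/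
def volterraLinearMap (hℓ : 0 < ℓ) : L2 ℓ →ₗ[ℂ] L2 ℓ where
  toFun F := restrictL2 hℓ (primitiveFun hℓ F)
  map_add' F G := by
    apply Lp.ext
    have h := Lp.coeFn_add F G
    filter_upwards [restrictL2_primitiveFun_ae hℓ (F + G), restrictL2_primitiveFun_ae hℓ F,
      restrictL2_primitiveFun_ae hℓ G, Lp.coeFn_add (restrictL2 hℓ (primitiveFun hℓ F))
      (restrictL2 hℓ (primitiveFun hℓ G)), ae_restrict_mem measurableSet_Ioo] with x h1 h2 h3 h4 hx
    have hl : -ℓ ∈ Icc (-ℓ) ℓ := left_mem_Icc.2 (by linarith)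
    rw [h1, h4, Pi.add_apply, h2, h3, intervalIntegral_congr_of_ae h le_rfl hx.2.le hx.1.le]
    exact intervalIntegral.integral_add (F.intervalIntegrable hℓ hl (Ioo_subset_Icc_self hx))
      (G.intervalIntegrable hℓ hl (Ioo_subset_Icc_self hx))
  map_smul' c F := by
    apply Lp.ext
    have h := Lp.coeFn_smul c F
    filter_upwards [restrictL2_primitiveFun_ae hℓ (c • F), restrictL2_primitiveFun_ae hℓ F,
      Lp.coeFn_smul c (restrictL2 hℓ (primitiveFun hℓ F)),
      ae_restrict_mem measurableSet_Ioo] with x h1 h2 h4 hx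
    rw [h1, RingHom.id_apply, h4, Pi.smul_apply, h2,
      intervalIntegral_congr_of_ae h le_rfl hx.2.le hx.1.le]
    exact intervalIntegral.integral_smul c F

/-- Primitives of the unit ball are bounded by `√(2ℓ)` and uniformly 1/2-Hölder, hence relatively
compact in the continuous functions by Arzelà–Ascoli, and these map continuously to `L²`. -/
theorem isCompactOperator_volterra (hℓ : 0 < ℓ) : IsCompactOperator (volterraLinearMap hℓ) := by
  have hl : -ℓ ∈ Icc (-ℓ) ℓ := left_mem_Icc.2 (by linarith)
  have hcpt : IsCompact (closure (primitiveFun hℓ '' Metric.ball 0 1)) := by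
    refine BoundedContinuousFunction.arzela_ascoli (Metric.closedBall 0 (√(2 * ℓ)))
      (isCompact_closedBall _ _) _ ?_ ?_
    · rintro _ x ⟨F, hF, rfl⟩
      rw [mem_closedBall_zero_iff, primitiveFun_apply]
      rw [mem_ball_zero_iff] at hF
      refine (F.norm_intervalIntegral_le hl x.2).trans ?_
      have h1 : √|-ℓ - x| ≤ √(2 * ℓ) := by
        apply Real.sqrt_le_sqrt
        rw [abs_le]
        constructor <;> linarith [x.2.1, x.2.2]
      calc √|-ℓ - x| * ‖F‖ ≤ √(2 * ℓ) * 1 := by gcongr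
        _ = _ := mul_one _
    · refine Metric.equicontinuous_of_continuity_modulus (fun r => √r) ?_ _ ?_
      · simpa using (Real.continuous_sqrt.tendsto 0)
      · rintro x y ⟨_, F, hF, rfl⟩
        rw [mem_ball_zero_iff] at hF
        simp only [primitiveFun_apply]
        rw [dist_eq_norm, intervalIntegral.integral_interval_sub_left
          (F.intervalIntegrable hℓ hl x.2) (F.intervalIntegrable hℓ hl y.2)]
        refine (F.norm_intervalIntegral_le y.2 x.2).trans ?_
        rw [abs_sub_comm]
        exact mul_le_of_le_one_right (Real.sqrt_nonneg _) hF.le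
  refine ⟨restrictL2 hℓ '' closure (primitiveFun hℓ '' Metric.ball 0 1),
    hcpt.image (continuous_restrictL2 hℓ), ?_⟩
  filter_upwards [Metric.ball_mem_nhds (0 : L2 ℓ) one_pos] with F hF
  exact ⟨_, subset_closure ⟨F, hF, rfl⟩, rfl⟩

/-- The Volterra operator on `L²(-ℓ, ℓ)`, as a continuous linear map. -/
def volterra (hℓ : 0 < ℓ) : L2 ℓ →L[ℂ] L2 ℓ :=
  ContinuousLinearMap.mkOfIsCompactOperator (isCompactOperator_volterra hℓ)

theorem volterra_ae (hℓ : 0 < ℓ) (F : L2 ℓ) :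
    volterra hℓ F =ᵐ[intervalMeasure ℓ] fun x => ∫ t in (-ℓ)..x, F t :=
  restrictL2_primitiveFun_ae hℓ F

theorem memLp_of_continuousOn {p : ℝ≥0∞} {m : ℝ → ℂ} (hm : ContinuousOn m (Icc (-ℓ) ℓ)) :
    MemLp m p (intervalMeasure ℓ) := by
  obtain ⟨C, hC⟩ := isCompact_Icc.exists_bound_of_continuousOn hm
  refine MemLp.of_bound ((hm.mono Ioo_subset_Icc_self).aestronglyMeasurable measurableSet_Ioo) C ?_
  filter_upwards [ae_restrict_mem measurableSet_Ioo] with x hx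
  exact hC x (Ioo_subset_Icc_self hx)

theorem MemLp.continuousOn_mul {m f : ℝ → ℂ} (hm : ContinuousOn m (Icc (-ℓ) ℓ))
    (hf : MemLp f 2 (intervalMeasure ℓ)) :
    MemLp (fun x => m x * f x) 2 (intervalMeasure ℓ) :=
  hf.mul (memLp_of_continuousOn (p := ⊤) hm)

/-- Multiplication by a continuous function on `L²(-ℓ, ℓ)`. -/
def mulOp {m : ℝ → ℂ} (hm : ContinuousOn m (Icc (-ℓ) ℓ)) : L2 ℓ →L[ℂ] L2 ℓ :=
  (ContinuousLinearMap.mul ℂ ℂ).holderL (intervalMeasure ℓ) ⊤ 2 2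
    ((memLp_of_continuousOn hm).toLp m)

theorem mulOp_ae {m : ℝ → ℂ} (hm : ContinuousOn m (Icc (-ℓ) ℓ)) (F : L2 ℓ) :
    mulOp hm F =ᵐ[intervalMeasure ℓ] fun x => m x * F x := by
  filter_upwards [(ContinuousLinearMap.mul ℂ ℂ).coeFn_holder (r := 2)
    ((memLp_of_continuousOn (p := ⊤) hm).toLp m) F,
    (memLp_of_continuousOn (p := ⊤) hm).coeFn_toLp] with x h1 h2
  refine h1.trans ?_
  rw [h2, ContinuousLinearMap.mul_apply']

end Operators

/-! ### Exponential weights and the Liouville transform. -/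

section Calculus

variable {ℓ : ℝ}

theorem absolutelyContinuousOnInterval_of_hasDerivWithinAt (hℓ : 0 < ℓ) {u u' : ℝ → ℂ}
    (h : ∀ x ∈ Icc (-ℓ) ℓ, HasDerivWithinAt u (u' x) (Icc (-ℓ) ℓ) x)
    (hc : ContinuousOn u' (Icc (-ℓ) ℓ)) : AbsolutelyContinuousOnInterval u (-ℓ) ℓ := by
  obtain ⟨C, hC⟩ := isCompact_Icc.exists_bound_of_continuousOn hc
  have hlip : LipschitzOnWith C.toNNReal u (Icc (-ℓ) ℓ) :=
    (convex_Icc _ _).lipschitzOnWith_of_nnnorm_hasDerivWithin_le h fun x hx => by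
      rw [← NNReal.coe_le_coe, coe_nnnorm]
      exact (hC x hx).trans (Real.le_coe_toNNReal C)
  apply LipschitzOnWith.absolutelyContinuousOnInterval (K := C.toNNReal)
  rwa [uIcc_of_le (by linarith)]

theorem _root_.LipschitzWith.absolutelyContinuousOnInterval_ofReal {K : NNReal} {a : ℝ → ℝ}
    (ha : LipschitzWith K a) (x y : ℝ) :
    AbsolutelyContinuousOnInterval (fun t => (a t : ℂ)) x y :=
  Complex.ofRealCLM.lipschitz.comp_absolutelyContinuousOnInterval
    (ha.lipschitzOnWith (s := uIcc x y)).absolutelyContinuousOnInterval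

theorem _root_.AbsolutelyContinuousOnInterval.mul_complex {f g : ℝ → ℂ} {x y : ℝ}
    (hf : AbsolutelyContinuousOnInterval f x y) (hg : AbsolutelyContinuousOnInterval g x y) :
    AbsolutelyContinuousOnInterval (fun t => f t * g t) x y := by
  simpa only [smul_eq_mul] using hf.fun_smul hg

theorem _root_.AbsolutelyContinuousOnInterval.continuousOn_symm_Icc (hℓ : 0 < ℓ) {f : ℝ → ℂ}
    (hf : AbsolutelyContinuousOnInterval f (-ℓ) ℓ) : ContinuousOn f (Icc (-ℓ) ℓ) := by
  have := hf.continuousOn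
  rwa [uIcc_of_le (by linarith)] at this

namespace IsDirichletH2

variable {u u' u'' : ℝ → ℂ}

theorem continuousOn (h : IsDirichletH2 ℓ u u' u'') : ContinuousOn u (Icc (-ℓ) ℓ) :=
  fun x hx => (h.hasDeriv x hx).continuousWithinAt

theorem hasDerivAt (h : IsDirichletH2 ℓ u u' u'') {x : ℝ} (hx : x ∈ Ioo (-ℓ) ℓ) :
    HasDerivAt u (u' x) x :=
  (h.hasDeriv x (Ioo_subset_Icc_self hx)).hasDerivAt (Icc_mem_nhds hx.1 hx.2)

theorem absCont_self (hℓ : 0 < ℓ) (h : IsDirichletH2 ℓ u u' u'') :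
    AbsolutelyContinuousOnInterval u (-ℓ) ℓ :=
  absolutelyContinuousOnInterval_of_hasDerivWithinAt hℓ h.hasDeriv
    (h.absCont.continuousOn_symm_Icc hℓ)

theorem ae_hasDerivAt_mul {K : NNReal} {a : ℝ → ℝ} (ha : LipschitzWith K a)
    (h : IsDirichletH2 ℓ u u' u'') :
    ∀ᵐ x ∂(intervalMeasure ℓ), HasDerivAt (fun y => (a y : ℂ) * u y)
      (((deriv a x : ℝ) : ℂ) * u x + (a x : ℂ) * u' x) x := by
  filter_upwards [ae_restrict_of_ae ha.ae_differentiableAt_real,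
    ae_restrict_mem measurableSet_Ioo] with x h1 hx
  exact h1.hasDerivAt.ofReal_comp.mul (h.hasDerivAt hx)

end IsDirichletH2

/-- The function `exp (s ∫_{-ℓ}^x a)`. -/
def expPrimitive (ℓ s : ℝ) (a : ℝ → ℝ) (x : ℝ) : ℝ := Real.exp (s * ∫ y in (-ℓ)..x, a y)

theorem expPrimitive_pos (ℓ s : ℝ) (a : ℝ → ℝ) (x : ℝ) : 0 < expPrimitive ℓ s a x :=
  Real.exp_pos _

theorem expPrimitive_neg_mul (ℓ s : ℝ) (a : ℝ → ℝ) (x : ℝ) :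
    expPrimitive ℓ (-s) a x * expPrimitive ℓ s a x = 1 := by
  rw [expPrimitive, expPrimitive, ← Real.exp_add]
  simp

theorem hasDerivAt_expPrimitive (s : ℝ) {a : ℝ → ℝ} (ha : Continuous a) (x : ℝ) :
    HasDerivAt (fun y => (expPrimitive ℓ s a y : ℂ))
      ((s : ℂ) * (a x : ℂ) * (expPrimitive ℓ s a x : ℂ)) x := by
  have h := ((ha.integral_hasStrictDerivAt (-ℓ) x).hasDerivAt.const_mul s).exp
  refine h.ofReal_comp.congr_deriv ?_
  rw [show expPrimitive ℓ s a x = Real.exp (s * ∫ y in (-ℓ)..x, a y) from rfl]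
  push_cast
  ring

theorem continuous_expPrimitive (s : ℝ) {a : ℝ → ℝ} (ha : Continuous a) :
    Continuous (fun y => (expPrimitive ℓ s a y : ℂ)) :=
  continuous_iff_continuousAt.2 fun x => (hasDerivAt_expPrimitive s ha x).continuousAt

theorem absolutelyContinuousOnInterval_expPrimitive (hℓ : 0 < ℓ) (s : ℝ) {a : ℝ → ℝ}
    (ha : Continuous a) :
    AbsolutelyContinuousOnInterval (fun y => (expPrimitive ℓ s a y : ℂ)) (-ℓ) ℓ := by
  refine absolutelyContinuousOnInterval_of_hasDerivWithinAt hℓ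
    (fun x _ => (hasDerivAt_expPrimitive s ha x).hasDerivWithinAt) (Continuous.continuousOn ?_)
  have := continuous_expPrimitive (ℓ := ℓ) s ha
  fun_prop

theorem memLp_deriv_mul {K : NNReal} {a : ℝ → ℝ} (ha : LipschitzWith K a) {m : ℝ → ℂ}
    (hm : ContinuousOn m (Icc (-ℓ) ℓ)) :
    MemLp (fun x => ((deriv a x : ℝ) : ℂ) * m x) 2 (intervalMeasure ℓ) := by
  have h1 : MemLp (fun x => ((deriv a x : ℝ) : ℂ)) ⊤ (intervalMeasure ℓ) := by
    refine MemLp.of_bound (Complex.measurable_ofReal.comp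
      (measurable_deriv a)).aestronglyMeasurable K (Filter.Eventually.of_forall fun x => ?_)
    rw [Complex.norm_real]
    exact norm_deriv_le_of_lipschitz ha
  exact (memLp_of_continuousOn (p := 2) hm).mul h1

/-- Serves the Liouville transform (`s = -1/2ε`), its inverse (`s = 1/2ε`) and the trial function.
The weight is only C¹ with Lipschitz logarithmic derivative, so `a'` enters the second derivative
merely as a bounded function; absolute continuity of the first derivative is therefore the
regularity to preserve. -/
theorem IsDirichletH2.mul_expPrimitive (hℓ : 0 < ℓ) (s : ℝ) {K : NNReal} {a : ℝ → ℝ}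
    (ha : LipschitzWith K a) {u u' u'' : ℝ → ℂ} (h : IsDirichletH2 ℓ u u' u'') :
    IsDirichletH2 ℓ (fun x => (expPrimitive ℓ s a x : ℂ) * u x)
      (fun x => (expPrimitive ℓ s a x : ℂ) * (u' x + (s : ℂ) * ((a x : ℂ) * u x)))
      (fun x => (expPrimitive ℓ s a x : ℂ) * (u'' x + 2 * (s : ℂ) * ((a x : ℂ) * u' x) +
        ((s : ℂ) * ((deriv a x : ℝ) : ℂ) + (s : ℂ) ^ 2 * (a x : ℂ) ^ 2) * u x)) := by
  have hac := ha.continuous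
  have hG := continuous_expPrimitive (ℓ := ℓ) s hac
  have hGc := hG.continuousOn (s := Icc (-ℓ) ℓ)
  have hacc : ContinuousOn (fun x => (a x : ℂ)) (Icc (-ℓ) ℓ) :=
    (Complex.continuous_ofReal.comp hac).continuousOn
  have hu := h.continuousOn
  have hu' := h.absCont.continuousOn_symm_Icc hℓ
  constructor
  · intro x hx
    refine ((hasDerivAt_expPrimitive s hac x).hasDerivWithinAt.mul
      (h.hasDeriv x hx)).congr_deriv ?_
    ring
  · exact (absolutelyContinuousOnInterval_expPrimitive hℓ s hac).mul_complex
      (h.absCont.fun_add (((ha.absolutelyContinuousOnInterval_ofReal _ _).mul_complex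
        (h.absCont_self hℓ)).const_smul (s : ℂ)))
  · filter_upwards [h.hasSecondDeriv, h.ae_hasDerivAt_mul ha] with x h1 h2
    refine ((hasDerivAt_expPrimitive s hac x).mul
      (h1.add (h2.const_mul (s : ℂ)))).congr_deriv ?_
    simp only [Pi.add_apply]
    ring
  · have h1 := MemLp.continuousOn_mul hGc h.memLp
    have h2 := memLp_deriv_mul ha (m := fun x => (s : ℂ) * ((expPrimitive ℓ s a x : ℂ) * u x))
      (by fun_prop)
    have h3 : MemLp (fun x => (expPrimitive ℓ s a x : ℂ) * (2 * (s : ℂ) * ((a x : ℂ) * u' x) +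
        (s : ℂ) ^ 2 * (a x : ℂ) ^ 2 * u x)) 2 (intervalMeasure ℓ) :=
      memLp_of_continuousOn (by fun_prop)
    refine ((h1.add h2).add h3).ae_eq (Filter.Eventually.of_forall fun x => ?_)
    simp only [Pi.add_apply]
    ring
  · simp [h.left]
  · simp [h.right]

theorem liouville_to_schrodinger (hℓ : 0 < ℓ) {ε : ℝ} (hε : 0 < ε) {K : NNReal} {a : ℝ → ℝ}
    (ha : LipschitzWith K a) {U F V G : L2 ℓ}
    (hV : V =ᵐ[intervalMeasure ℓ] fun x => (liouvilleFactor ℓ ε a x : ℂ) * U x)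
    (hG : G =ᵐ[intervalMeasure ℓ] fun x => (ε : ℂ) * (liouvilleFactor ℓ ε a x : ℂ) * F x)
    (h : transportOp ℓ ε a U F) : schrodingerOp ℓ ε a V G := by
  obtain ⟨u, u', u'', hu, hU, hF⟩ := h
  have hg : ∀ x, liouvilleFactor ℓ ε a x = expPrimitive ℓ (-(1 / (2 * ε))) a x := fun _ => rfl
  refine ⟨_, _, _, hu.mul_expPrimitive hℓ (-(1 / (2 * ε))) ha, ?_, ?_⟩
  · filter_upwards [hV, hU] with x h1 h2
    rw [h1, h2, hg]
  · have hε' : (ε : ℂ) ≠ 0 := by exact_mod_cast hε.ne'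
    filter_upwards [hG, hF, hu.ae_hasDerivAt_mul ha] with x h1 h2 h3
    rw [h1, h2, h3.deriv, hg, potential]
    push_cast
    field_simp
    ring

theorem liouville_of_schrodinger (hℓ : 0 < ℓ) {ε : ℝ} (hε : 0 < ε) {K : NNReal} {a : ℝ → ℝ}
    (ha : LipschitzWith K a) {U F V G : L2 ℓ}
    (hV : V =ᵐ[intervalMeasure ℓ] fun x => (liouvilleFactor ℓ ε a x : ℂ) * U x)
    (hG : G =ᵐ[intervalMeasure ℓ] fun x => (ε : ℂ) * (liouvilleFactor ℓ ε a x : ℂ) * F x)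
    (h : schrodingerOp ℓ ε a V G) : transportOp ℓ ε a U F := by
  obtain ⟨v, v', v'', hv, hVv, hGv⟩ := h
  have hg : ∀ x, liouvilleFactor ℓ ε a x = expPrimitive ℓ (-(1 / (2 * ε))) a x := fun _ => rfl
  have hinv : ∀ x, (expPrimitive ℓ (1 / (2 * ε)) a x : ℂ) *
      (expPrimitive ℓ (-(1 / (2 * ε))) a x : ℂ) = 1 := fun x => by
    rw [mul_comm]; exact_mod_cast expPrimitive_neg_mul ℓ (1 / (2 * ε)) a x
  have hu := hv.mul_expPrimitive hℓ (1 / (2 * ε)) ha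
  have hε' : (ε : ℂ) ≠ 0 := by exact_mod_cast hε.ne'
  refine ⟨_, _, _, hu, ?_, ?_⟩
  · filter_upwards [hV, hVv] with x h1 h2
    rw [← h2, h1, hg, ← mul_assoc, hinv, one_mul]
  · filter_upwards [hG, hGv, hu.ae_hasDerivAt_mul ha] with x h1 h2 h3
    have e : (F x : ℂ) = (expPrimitive ℓ (1 / (2 * ε)) a x : ℂ) * ((ε : ℂ)⁻¹ * G x) := by
      rw [h1, hg]
      calc (F x : ℂ) = (ε : ℂ)⁻¹ * ε * (1 * F x) := by rw [inv_mul_cancel₀ hε']; ring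
        _ = _ := by rw [← hinv x]; ring
    rw [e, h2, h3.deriv, potential]
    push_cast
    field_simp
    ring

end Calculus

/-! ### The compact inverse of the transport operator. -/

section TransportInverse

variable {ℓ ε : ℝ} {K : NNReal} {a : ℝ → ℝ}

/-- The function `ε⁻¹ e^{A/ε} ∫_{-ℓ}^x e^{-A/ε} (∫_{-ℓ}^y f - c) dy`, where `A` is the primitive of
`a`: the solution of `ε u' - a u = ∫_{-ℓ}^x f - c` that vanishes at `-ℓ`. -/
def transportSolution (ℓ ε : ℝ) (a : ℝ → ℝ) (f : ℝ → ℂ) (c : ℂ) (x : ℝ) : ℂ :=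
  (ε : ℂ)⁻¹ * ((expPrimitive ℓ (1 / ε) a x : ℂ) *
    ∫ y in (-ℓ)..x, (expPrimitive ℓ (-(1 / ε)) a y : ℂ) * ((∫ t in (-ℓ)..y, f t) - c))

theorem transportSolution_congr {f g : ℝ → ℂ} (h : f =ᵐ[intervalMeasure ℓ] g) (c : ℂ) {x : ℝ}
    (hx : x ∈ Icc (-ℓ) ℓ) :
    transportSolution ℓ ε a f c x = transportSolution ℓ ε a g c x := by
  unfold transportSolution
  congr 2
  refine intervalIntegral.integral_congr fun y hy => ?_
  rw [uIcc_of_le hx.1] at hy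
  rw [intervalIntegral_congr_of_ae h le_rfl (hy.2.trans hx.2) hy.1]

theorem expPrimitive_mul_neg_complex (s x : ℝ) :
    (expPrimitive ℓ s a x : ℂ) * (expPrimitive ℓ (-s) a x : ℂ) = 1 := by
  rw [mul_comm]; exact_mod_cast expPrimitive_neg_mul ℓ s a x

theorem hasDerivAt_transportSolution (hε : 0 < ε) (ha : Continuous a) {f : ℝ → ℂ}
    (hf : Integrable f) (c : ℂ) (x : ℝ) :
    HasDerivAt (transportSolution ℓ ε a f c)
      ((ε : ℂ)⁻¹ * ((a x : ℂ) * transportSolution ℓ ε a f c x + ((∫ t in (-ℓ)..x, f t) - c))) x := by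
  have hε' : (ε : ℂ) ≠ 0 := by exact_mod_cast hε.ne'
  have hp : Continuous fun y => (expPrimitive ℓ (-(1 / ε)) a y : ℂ) * ((∫ t in (-ℓ)..y, f t) - c) :=
    (continuous_expPrimitive _ ha).mul ((intervalIntegral.continuous_primitive
      (fun _ _ => hf.intervalIntegrable) _).sub continuous_const)
  have h := (((hasDerivAt_expPrimitive (ℓ := ℓ) (1 / ε) ha x).mul
    (hp.integral_hasStrictDerivAt (-ℓ) x).hasDerivAt).const_mul (ε : ℂ)⁻¹)
  refine h.congr_deriv ?_
  rw [← mul_assoc (expPrimitive ℓ (1 / ε) a x : ℂ), expPrimitive_mul_neg_complex]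
  unfold transportSolution
  push_cast
  field_simp

theorem isDirichletH2_transportSolution (hℓ : 0 < ℓ) (hε : 0 < ε) (ha : LipschitzWith K a)
    {f : ℝ → ℂ} (hf : Integrable f) (hf2 : MemLp f 2 (intervalMeasure ℓ)) (c : ℂ)
    (hend : transportSolution ℓ ε a f c ℓ = 0) :
    IsDirichletH2 ℓ (transportSolution ℓ ε a f c)
      (fun x => (ε : ℂ)⁻¹ * ((a x : ℂ) * transportSolution ℓ ε a f c x
        + ((∫ t in (-ℓ)..x, f t) - c)))
      (fun x => (ε : ℂ)⁻¹ * (((deriv a x : ℝ) : ℂ) * transportSolution ℓ ε a f c x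
        + (a x : ℂ) * ((ε : ℂ)⁻¹ * ((a x : ℂ) * transportSolution ℓ ε a f c x
        + ((∫ t in (-ℓ)..x, f t) - c))) + f x)) := by
  have hac := ha.continuous
  have hacc : Continuous (fun x => (a x : ℂ)) := Complex.continuous_ofReal.comp hac
  have hd := hasDerivAt_transportSolution (ℓ := ℓ) hε hac hf c
  have hp : Continuous fun y => (∫ t in (-ℓ)..y, f t) - c :=
    (intervalIntegral.continuous_primitive (fun _ _ => hf.intervalIntegrable) _).sub
      continuous_const
  have hu : Continuous (transportSolution ℓ ε a f c) :=
    continuous_iff_continuousAt.2 fun x => (hd x).continuousAt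
  have hu' : Continuous fun x => (ε : ℂ)⁻¹ * ((a x : ℂ) * transportSolution ℓ ε a f c x
        + ((∫ t in (-ℓ)..x, f t) - c)) := by fun_prop
  constructor
  · exact fun x _ => (hd x).hasDerivWithinAt
  · have hAC := absolutelyContinuousOnInterval_of_hasDerivWithinAt hℓ
      (fun x _ => (hd x).hasDerivWithinAt) hu'.continuousOn
    have hpAC := absolutelyContinuousOnInterval_intervalIntegral_complex
      (hf.intervalIntegrable (a := -ℓ) (b := ℓ)) (c := -ℓ) left_mem_uIcc
    have hcAC : AbsolutelyContinuousOnInterval (fun _ : ℝ => c) (-ℓ) ℓ :=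
      (LipschitzWith.const c).lipschitzOnWith.absolutelyContinuousOnInterval
    exact (((ha.absolutelyContinuousOnInterval_ofReal _ _).mul_complex hAC).fun_add
      (hpAC.fun_sub hcAC)).const_smul (ε : ℂ)⁻¹
  · filter_upwards [ae_restrict_of_ae ha.ae_differentiableAt_real,
      ae_restrict_of_ae (LocallyIntegrable.ae_hasDerivAt_integral hf.locallyIntegrable)] with x h1 h2
    exact ((h1.hasDerivAt.ofReal_comp.mul (hd x)).add ((h2 (-ℓ)).sub_const c)).const_mul _
  · have h1 := memLp_deriv_mul (ℓ := ℓ) ha hu.continuousOn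
    have h2 : MemLp (fun x => (a x : ℂ) * ((ε : ℂ)⁻¹ * ((a x : ℂ) * transportSolution ℓ ε a f c x
        + ((∫ t in (-ℓ)..x, f t) - c)))) 2 (intervalMeasure ℓ) :=
      memLp_of_continuousOn (by fun_prop)
    exact ((h1.add h2).add hf2).const_mul _
  · simp [transportSolution]
  · exact hend

theorem transportOp_transportSolution (hℓ : 0 < ℓ) (hε : 0 < ε) (ha : LipschitzWith K a)
    {U F : L2 ℓ} {c : ℂ} (hend : transportSolution ℓ ε a F c ℓ = 0)
    (hU : U =ᵐ[intervalMeasure ℓ] transportSolution ℓ ε a F c) : transportOp ℓ ε a U F := by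
  have hε' : (ε : ℂ) ≠ 0 := by exact_mod_cast hε.ne'
  -- The representative of `F` is arbitrary outside the interval; extending by zero makes it
  -- integrable on the whole line, so its primitive can be differentiated without boundary care.
  set f : ℝ → ℂ := (Ioo (-ℓ) ℓ).indicator F with hfdef
  have hfF : F =ᵐ[intervalMeasure ℓ] f := by
    filter_upwards [ae_restrict_mem measurableSet_Ioo] with x hx
    rw [hfdef, indicator_of_mem hx]
  have hf : Integrable f :=
    (integrable_indicator_iff measurableSet_Ioo).2 ((Lp.memLp F).integrable (by norm_num))
  have hf2 : MemLp f 2 (intervalMeasure ℓ) := (Lp.memLp F).ae_eq hfF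
  have hs : ∀ x ∈ Icc (-ℓ) ℓ, transportSolution ℓ ε a F c x = transportSolution ℓ ε a f c x :=
    fun x hx => transportSolution_congr hfF c hx
  have hD := isDirichletH2_transportSolution hℓ hε ha hf hf2 c
    ((hs ℓ (right_mem_Icc.2 (by linarith))).symm.trans hend)
  refine ⟨_, _, _, hD, ?_, ?_⟩
  · filter_upwards [hU, ae_restrict_mem measurableSet_Ioo] with x h1 hx
    rw [h1, hs x (Ioo_subset_Icc_self hx)]
  · filter_upwards [hfF, hD.ae_hasDerivAt_mul ha] with x h1 h2
    rw [h2.deriv, h1, mul_inv_cancel_left₀ hε']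
    ring

/-- Uniqueness: the flux `ε u' - a u` is absolutely continuous with derivative `F`, so it equals `∫
F - c`; multiplication by `e^{-A/ε}` then turns the left side into `ε (e^{-A/ε} u)'`, which
integrates from `u(-ℓ) = 0`. -/
theorem exists_eq_transportSolution (hℓ : 0 < ℓ) (hε : 0 < ε) (ha : LipschitzWith K a)
    {U F : L2 ℓ} (h : transportOp ℓ ε a U F) :
    ∃ c : ℂ, transportSolution ℓ ε a F c ℓ = 0 ∧
      U =ᵐ[intervalMeasure ℓ] transportSolution ℓ ε a F c := by
  have hε' : (ε : ℂ) ≠ 0 := by exact_mod_cast hε.ne'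
  obtain ⟨u, u', u'', hu, hU, hF⟩ := h
  have hac := ha.continuous
  have hneg : -ℓ ≤ ℓ := by linarith
  have hq : AbsolutelyContinuousOnInterval (fun x => (ε : ℂ) * u' x - (a x : ℂ) * u x) (-ℓ) ℓ :=
    (hu.absCont.const_smul (ε : ℂ)).fun_sub
      ((ha.absolutelyContinuousOnInterval_ofReal _ _).mul_complex (hu.absCont_self hℓ))
  have hq' : ∀ᵐ x ∂(intervalMeasure ℓ),
      HasDerivAt (fun x => (ε : ℂ) * u' x - (a x : ℂ) * u x) (F x) x := by
    filter_upwards [hu.hasSecondDeriv, hu.ae_hasDerivAt_mul ha, hF] with x h1 h2 h3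
    rw [h3, h2.deriv]
    exact (h1.const_mul _).sub h2
  obtain ⟨-, hqint⟩ := intervalIntegrable_and_integral_of_absolutelyContinuous hneg hq hq'
  -- The constant is minus the flux at the left end.
  set c : ℂ := -((ε : ℂ) * u' (-ℓ) - (a (-ℓ) : ℂ) * u (-ℓ)) with hc
  have hw : AbsolutelyContinuousOnInterval
      (fun x => (expPrimitive ℓ (-(1 / ε)) a x : ℂ) * u x) (-ℓ) ℓ :=
    (absolutelyContinuousOnInterval_expPrimitive hℓ _ hac).mul_complex (hu.absCont_self hℓ)
  have hw' : ∀ᵐ x ∂(intervalMeasure ℓ),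
      HasDerivAt (fun x => (expPrimitive ℓ (-(1 / ε)) a x : ℂ) * u x)
        ((ε : ℂ)⁻¹ * ((expPrimitive ℓ (-(1 / ε)) a x : ℂ) * ((∫ t in (-ℓ)..x, F t) - c))) x := by
    filter_upwards [ae_restrict_mem measurableSet_Ioo] with x hx
    refine ((hasDerivAt_expPrimitive _ hac x).mul (hu.hasDerivAt hx)).congr_deriv ?_
    rw [hqint x (Ioo_subset_Icc_self hx), hc]
    push_cast
    field_simp
    ring
  obtain ⟨-, hwint⟩ := intervalIntegrable_and_integral_of_absolutelyContinuous hneg hw hw'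
  have key : ∀ x ∈ Icc (-ℓ) ℓ, u x = transportSolution ℓ ε a F c x := by
    intro x hx
    have h1 := hwint x hx
    rw [intervalIntegral.integral_const_mul, hu.left, mul_zero, sub_zero] at h1
    rw [transportSolution, mul_left_comm, h1, ← mul_assoc, expPrimitive_mul_neg_complex, one_mul]
  refine ⟨c, ?_, ?_⟩
  · rw [← key ℓ (right_mem_Icc.2 hneg), hu.right]
  · filter_upwards [hU, ae_restrict_mem measurableSet_Ioo] with x h1 hx
    rw [h1, key x (Ioo_subset_Icc_self hx)]

/-- The constant `∫ e^{-A/ε}`. -/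
def weightMass (ℓ ε : ℝ) (a : ℝ → ℝ) : ℂ :=
  ∫ y in (-ℓ)..ℓ, (expPrimitive ℓ (-(1 / ε)) a y : ℂ)

theorem weightMass_ne_zero (hℓ : 0 < ℓ) (ha : Continuous a) : weightMass ℓ ε a ≠ 0 := by
  have hc : Continuous (expPrimitive ℓ (-(1 / ε)) a) := by
    simpa [Function.comp_def] using
      Complex.continuous_re.comp (continuous_expPrimitive (ℓ := ℓ) (-(1 / ε)) ha)
  have h := intervalIntegral.intervalIntegral_pos_of_pos
    (hc.intervalIntegrable (μ := volume) (-ℓ) ℓ) (fun x => expPrimitive_pos _ _ _ _) (by linarith)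
  rw [weightMass, intervalIntegral.integral_ofReal]
  exact_mod_cast ne_of_gt h

/-- The constant of integration for which the transport solution vanishes at `ℓ`. -/
def boundaryConst (ℓ ε : ℝ) (a : ℝ → ℝ) (f : ℝ → ℂ) : ℂ :=
  (weightMass ℓ ε a)⁻¹ *
    ∫ y in (-ℓ)..ℓ, (expPrimitive ℓ (-(1 / ε)) a y : ℂ) * ∫ t in (-ℓ)..y, f t

/-- The value at `ℓ` is affine in `c`, with slope a nonzero multiple of `weightMass`, hence nonzero.
-/
theorem transportSolution_right_eq_zero_iff (hℓ : 0 < ℓ) (hε : 0 < ε) (ha : Continuous a)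
    (F : L2 ℓ) (c : ℂ) :
    transportSolution ℓ ε a F c ℓ = 0 ↔ c = boundaryConst ℓ ε a F := by
  have hε' : (ε : ℂ) ≠ 0 := by exact_mod_cast hε.ne'
  have hE : (expPrimitive ℓ (1 / ε) a ℓ : ℂ) ≠ 0 := by
    exact_mod_cast (expPrimitive_pos ℓ (1 / ε) a ℓ).ne'
  have hN := weightMass_ne_zero (ε := ε) hℓ ha
  have hneg : -ℓ ≤ ℓ := by linarith
  have hFi : IntegrableOn F (uIcc (-ℓ) ℓ) := by
    have := F.intervalIntegrable hℓ (left_mem_Icc.2 hneg) (right_mem_Icc.2 hneg)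
    rwa [intervalIntegrable_iff'] at this
  have hEc := continuous_expPrimitive (ℓ := ℓ) (-(1 / ε)) ha
  have hP := intervalIntegral.continuousOn_primitive_interval hFi
  have hsplit : ∫ y in (-ℓ)..ℓ, (expPrimitive ℓ (-(1 / ε)) a y : ℂ) * ((∫ t in (-ℓ)..y, F t) - c) =
      (∫ y in (-ℓ)..ℓ, (expPrimitive ℓ (-(1 / ε)) a y : ℂ) * ∫ t in (-ℓ)..y, F t)
        - weightMass ℓ ε a * c := by
    have h1 : IntervalIntegrable (fun y => (expPrimitive ℓ (-(1 / ε)) a y : ℂ) *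
        ∫ t in (-ℓ)..y, F t) volume (-ℓ) ℓ := (hEc.continuousOn.mul hP).intervalIntegrable
    have h2 : IntervalIntegrable (fun y => (expPrimitive ℓ (-(1 / ε)) a y : ℂ) * c) volume (-ℓ) ℓ :=
      (hEc.mul continuous_const).intervalIntegrable _ _
    simp_rw [mul_sub]
    rw [intervalIntegral.integral_sub h1 h2, intervalIntegral.integral_mul_const, weightMass]
  rw [transportSolution, boundaryConst, hsplit]
  simp only [mul_eq_zero, inv_eq_zero, hε', hE, false_or]
  rw [sub_eq_zero, eq_inv_mul_iff_mul_eq₀ hN, eq_comm]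

theorem exists_transport_inverse (hℓ : 0 < ℓ) (hε : 0 < ε) (ha : LipschitzWith K a) :
    ∃ R : L2 ℓ →L[ℂ] L2 ℓ, IsCompactOperator R ∧ ∀ U F, transportOp ℓ ε a U F ↔ U = R F := by
  have hac := ha.continuous
  have hneg : -ℓ ≤ ℓ := by linarith
  have hE1 := (continuous_expPrimitive (ℓ := ℓ) (1 / ε) hac).continuousOn (s := Icc (-ℓ) ℓ)
  have hE2 := (continuous_expPrimitive (ℓ := ℓ) (-(1 / ε)) hac).continuousOn (s := Icc (-ℓ) ℓ)
  have hmE := memLp_of_continuousOn (p := 2) hE2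
  have hm1 := memLp_of_continuousOn (p := 2) (ℓ := ℓ) (m := fun _ => (1 : ℂ)) continuousOn_const
  set E : L2 ℓ := hmE.toLp _ with hEdef
  set one : L2 ℓ := hm1.toLp _ with honedef
  -- Applied to the primitive of `F`, this rank-one perturbation of the identity subtracts the
  -- constant `boundaryConst`: pairing with the real weight `E` is exactly the integral defining it.
  set P : L2 ℓ →L[ℂ] L2 ℓ := ContinuousLinearMap.id ℂ _ -
    ((weightMass ℓ ε a)⁻¹ • innerSL ℂ E).smulRight one with hPdef
  set R : L2 ℓ →L[ℂ] L2 ℓ := ((ε : ℂ)⁻¹ • mulOp hE1).comp ((volterra hℓ).comp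
    (((mulOp hE2).comp P).comp (volterra hℓ))) with hRdef
  have hin : ∀ F : L2 ℓ, inner ℂ E (volterra hℓ F) =
      ∫ y in (-ℓ)..ℓ, (expPrimitive ℓ (-(1 / ε)) a y : ℂ) * ∫ t in (-ℓ)..y, F t := by
    intro F
    rw [intervalIntegral_eq_integral_interval hℓ, L2.inner_def]
    refine integral_congr_ae ?_
    filter_upwards [hmE.coeFn_toLp, volterra_ae hℓ F] with x h1 h2
    rw [hEdef, h1, h2, RCLike.inner_apply, Complex.conj_ofReal, mul_comm]
  have hR : ∀ F : L2 ℓ,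
      R F =ᵐ[intervalMeasure ℓ] transportSolution ℓ ε a F (boundaryConst ℓ ε a F) := by
    intro F
    set H : L2 ℓ := mulOp hE2 (P (volterra hℓ F)) with hH
    have hP : P (volterra hℓ F) = volterra hℓ F - (boundaryConst ℓ ε a F) • one := by
      simp [hPdef, hin, boundaryConst]
    have hHae : H =ᵐ[intervalMeasure ℓ] fun y => (expPrimitive ℓ (-(1 / ε)) a y : ℂ) *
        ((∫ t in (-ℓ)..y, F t) - boundaryConst ℓ ε a F) := by
      filter_upwards [mulOp_ae hE2 (P (volterra hℓ F)), volterra_ae hℓ F, hm1.coeFn_toLp,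
        Lp.coeFn_sub (volterra hℓ F) ((boundaryConst ℓ ε a F) • one),
        Lp.coeFn_smul (boundaryConst ℓ ε a F) one] with x h1 h2 h3 h4 h5
      rw [hH, h1, hP, h4, Pi.sub_apply, h5, Pi.smul_apply, h2, honedef, h3]
      simp
    have hRF : R F = (ε : ℂ)⁻¹ • mulOp hE1 (volterra hℓ H) := by
      simp [hRdef, hH]
    rw [hRF]
    filter_upwards [Lp.coeFn_smul (ε : ℂ)⁻¹ (mulOp hE1 (volterra hℓ H)),
      mulOp_ae hE1 (volterra hℓ H), volterra_ae hℓ H,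
      ae_restrict_mem measurableSet_Ioo] with x h1 h2 h3 hx
    rw [h1, Pi.smul_apply, h2, h3, smul_eq_mul, transportSolution,
      intervalIntegral_congr_of_ae hHae le_rfl hx.2.le hx.1.le]
  refine ⟨R, ?_, fun U F => ⟨fun h => ?_, fun h => ?_⟩⟩
  · exact ((isCompactOperator_volterra hℓ).comp_clm
      (((mulOp hE2).comp P).comp (volterra hℓ))).clm_comp ((ε : ℂ)⁻¹ • mulOp hE1)
  · obtain ⟨c, hc, hU⟩ := exists_eq_transportSolution hℓ hε ha h
    rw [transportSolution_right_eq_zero_iff hℓ hε hac] at hc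
    subst hc
    exact Lp.ext (hU.trans (hR F).symm)
  · subst h
    exact transportOp_transportSolution hℓ hε ha
      ((transportSolution_right_eq_zero_iff hℓ hε hac F _).2 rfl) (hR F)

end TransportInverse

/-! ### The Schrödinger operator: inverse, sign, and invariance. -/

section Schrodinger

variable {ℓ ε : ℝ} {K : NNReal} {a : ℝ → ℝ}

/-- Conjugation: if `R` inverts `𝓛` and `g` is the Liouville factor, then `g R ε⁻¹ g⁻¹` inverts `𝓜`,
and compactness survives composition with bounded operators. -/
theorem exists_schrodinger_inverse (hℓ : 0 < ℓ) (hε : 0 < ε) (ha : LipschitzWith K a) :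
    ∃ S : L2 ℓ →L[ℂ] L2 ℓ, IsCompactOperator S ∧ ∀ V G, schrodingerOp ℓ ε a V G ↔ V = S G := by
  obtain ⟨R, hRc, hR⟩ := exists_transport_inverse hℓ hε ha
  have hac := ha.continuous
  have hε' : (ε : ℂ) ≠ 0 := by exact_mod_cast hε.ne'
  have hg := (continuous_expPrimitive (ℓ := ℓ) (-(1 / (2 * ε))) hac).continuousOn
    (s := Icc (-ℓ) ℓ)
  have hgi := (continuous_expPrimitive (ℓ := ℓ) (1 / (2 * ε)) hac).continuousOn
    (s := Icc (-ℓ) ℓ)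
  have hl : ∀ V, mulOp hg (mulOp hgi V) = V := fun V => by
    apply Lp.ext
    filter_upwards [mulOp_ae hg (mulOp hgi V), mulOp_ae hgi V] with x h1 h2
    rw [h1, h2, ← mul_assoc, mul_comm (expPrimitive ℓ (-(1 / (2 * ε))) a x : ℂ),
      expPrimitive_mul_neg_complex, one_mul]
  have hr : ∀ V, mulOp hgi (mulOp hg V) = V := fun V => by
    apply Lp.ext
    filter_upwards [mulOp_ae hgi (mulOp hg V), mulOp_ae hg V] with x h1 h2
    rw [h1, h2, ← mul_assoc, expPrimitive_mul_neg_complex, one_mul]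
  refine ⟨(mulOp hg).comp (R.comp ((ε : ℂ)⁻¹ • mulOp hgi)),
    (hRc.comp_clm ((ε : ℂ)⁻¹ • mulOp hgi)).clm_comp (mulOp hg), fun V G => ?_⟩
  have hiff : transportOp ℓ ε a (mulOp hgi V) ((ε : ℂ)⁻¹ • mulOp hgi G) ↔
      schrodingerOp ℓ ε a V G := by
    have h1 : V =ᵐ[intervalMeasure ℓ]
        fun x => (liouvilleFactor ℓ ε a x : ℂ) * (mulOp hgi V) x := by
      have := mulOp_ae hg (mulOp hgi V)
      rwa [hl] at this
    have h2 : G =ᵐ[intervalMeasure ℓ] fun x => (ε : ℂ) * (liouvilleFactor ℓ ε a x : ℂ) *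
        ((ε : ℂ)⁻¹ • mulOp hgi G : L2 ℓ) x := by
      have := mulOp_ae hg (mulOp hgi G)
      rw [hl] at this
      filter_upwards [this, Lp.coeFn_smul (ε : ℂ)⁻¹ (mulOp hgi G)] with x e1 e2
      rw [e2, Pi.smul_apply, smul_eq_mul, e1, mul_right_comm, mul_inv_cancel_left₀ hε', mul_comm]
      rfl
    exact ⟨liouville_to_schrodinger hℓ hε ha h1 h2, liouville_of_schrodinger hℓ hε ha h1 h2⟩
  rw [← hiff, hR]
  constructor
  · intro h
    rw [← hl V, h]
    rfl
  · intro h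
    rw [h]
    exact hr _

/-- With `p = ε v' - a v / 2` the factorization reads `𝓜 v = ε p' + (a/2) p`, so `(ε v̄ p)' = |p|² +
v̄ 𝓜 v`. Integrating, the boundary terms vanish and `r = -∫ |p|²`. -/
theorem inner_schrodingerOp_nonpos (hℓ : 0 < ℓ) (ha : LipschitzWith K a) {V G : L2 ℓ}
    (h : schrodingerOp ℓ ε a V G) : ∃ r : ℝ, r ≤ 0 ∧ inner ℂ V G = r := by
  obtain ⟨v, v', v'', hv, hV, hG⟩ := h
  have hneg : -ℓ ≤ ℓ := by linarith
  have hacc : Continuous (fun x => (a x : ℂ)) := Complex.continuous_ofReal.comp ha.continuous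
  set p : ℝ → ℂ := fun x => (ε : ℂ) * v' x - (1 / 2 : ℂ) * ((a x : ℂ) * v x) with hp
  have hpAC : AbsolutelyContinuousOnInterval p (-ℓ) ℓ :=
    (hv.absCont.const_smul (ε : ℂ)).fun_sub
      (((ha.absolutelyContinuousOnInterval_ofReal _ _).mul_complex
        (hv.absCont_self hℓ)).const_smul (1 / 2 : ℂ))
  have hpc := hpAC.continuousOn_symm_Icc hℓ
  have hWAC : AbsolutelyContinuousOnInterval
      (fun x => Complex.conjCLE (v x) * ((ε : ℂ) * p x)) (-ℓ) ℓ :=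
    (Complex.conjCLE.toContinuousLinearMap.lipschitz.comp_absolutelyContinuousOnInterval
      (hv.absCont_self hℓ)).mul_complex (hpAC.const_smul (ε : ℂ))
  have hW : ∀ᵐ x ∂(intervalMeasure ℓ),
      HasDerivAt (fun x => Complex.conjCLE (v x) * ((ε : ℂ) * p x))
        (((‖p x‖ ^ 2 : ℝ) : ℂ) + inner ℂ (V x) (G x)) x := by
    filter_upwards [hv.hasSecondDeriv, hv.ae_hasDerivAt_mul ha, hV, hG,
      ae_restrict_mem measurableSet_Ioo] with x h1 h2 h3 h4 hx
    have e1 := Complex.conjCLE.toContinuousLinearMap.hasFDerivAt.comp_hasDerivAt x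
      (hv.hasDerivAt hx)
    have e2 := ((h1.const_mul (ε : ℂ)).sub (h2.const_mul (1 / 2 : ℂ))).const_mul (ε : ℂ)
    refine (e1.mul e2).congr_deriv ?_
    rw [h3, h4, RCLike.inner_apply]
    push_cast
    rw [← Complex.conj_mul' (p x), potential]
    simp only [hp, Complex.conjCLE_apply, Function.comp_apply,
      map_sub, map_mul, Complex.conj_ofReal, Pi.sub_apply, map_div₀, map_one, map_ofNat]
    push_cast
    ring
  obtain ⟨hint, hFTC⟩ := intervalIntegrable_and_integral_of_absolutelyContinuous hneg hWAC hW
  have hpi : IntervalIntegrable (fun x => ((‖p x‖ ^ 2 : ℝ) : ℂ)) volume (-ℓ) ℓ := by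
    apply ContinuousOn.intervalIntegrable
    rw [uIcc_of_le hneg]
    exact Complex.continuous_ofReal.comp_continuousOn (hpc.norm.pow 2)
  have hVi : IntervalIntegrable (fun x => inner ℂ (V x) (G x)) volume (-ℓ) ℓ := by
    simpa using hint.sub hpi
  have h0 := hFTC ℓ (right_mem_Icc.2 hneg)
  rw [intervalIntegral.integral_add hpi hVi, hv.left, hv.right,
    intervalIntegral.integral_ofReal] at h0
  refine ⟨-∫ x in (-ℓ)..ℓ, ‖p x‖ ^ 2, ?_, ?_⟩
  · rw [neg_nonpos]
    exact intervalIntegral.integral_nonneg hneg fun x _ => by positivity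
  · rw [L2.inner_def, ← intervalIntegral_eq_integral_interval hℓ]
    simp only [map_zero, zero_mul, sub_zero] at h0
    rw [Complex.ofReal_neg]
    exact (neg_eq_of_add_eq_zero_right h0).symm

/-- Single-valuedness at 0: a continuous representative that vanishes almost everywhere vanishes on
the open interval, and so do its derivatives. This gives injectivity of the inverse. -/
theorem eq_zero_of_schrodingerOp_zero {G : L2 ℓ} (h : schrodingerOp ℓ ε a 0 G) : G = 0 := by
  obtain ⟨v, v', v'', hv, hV, hG⟩ := h
  have h0 : EqOn v 0 (Ioo (-ℓ) ℓ) := by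
    refine Measure.eqOn_open_of_ae_eq (μ := volume) ?_ isOpen_Ioo
      (hv.continuousOn.mono Ioo_subset_Icc_self) continuousOn_const
    exact hV.symm.trans (Lp.coeFn_zero _ _ _)
  have h1 : EqOn v' 0 (Ioo (-ℓ) ℓ) := fun x hx =>
    (hv.hasDerivAt hx).unique ((hasDerivAt_const x (0 : ℂ)).congr_of_eventuallyEq
      (Filter.eventuallyEq_of_mem (Ioo_mem_nhds hx.1 hx.2) h0))
  apply Lp.ext
  filter_upwards [hG, hv.hasSecondDeriv, Lp.coeFn_zero ℂ 2 (intervalMeasure ℓ),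
    ae_restrict_mem measurableSet_Ioo] with x e1 e2 e3 hx
  have h2 : v'' x = 0 := e2.unique ((hasDerivAt_const x (0 : ℂ)).congr_of_eventuallyEq
      (Filter.eventuallyEq_of_mem (Ioo_mem_nhds hx.1 hx.2) h1))
  rw [e1, e3, h2, h0 hx]
  simp

/-- At interior points `deriv` sees only the germ of the coefficient. This and the next two lemmas
allow a coefficient that is Lipschitz on `[-ℓ, ℓ]` to be replaced by a Lipschitz extension to the
line. -/
theorem schrodingerOp_congr {a₁ a₂ : ℝ → ℝ} (h : EqOn a₁ a₂ (Icc (-ℓ) ℓ)) {V G : L2 ℓ}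
    (hV : schrodingerOp ℓ ε a₁ V G) : schrodingerOp ℓ ε a₂ V G := by
  obtain ⟨v, v', v'', hv, hV, hG⟩ := hV
  refine ⟨v, v', v'', hv, hV, ?_⟩
  filter_upwards [hG, ae_restrict_mem measurableSet_Ioo] with x h1 hx
  have hev : a₁ =ᶠ[nhds x] a₂ := Filter.eventuallyEq_of_mem (Icc_mem_nhds hx.1 hx.2) h
  rw [h1, potential, potential, hev.deriv_eq, h (Ioo_subset_Icc_self hx)]

theorem transportOp_congr {a₁ a₂ : ℝ → ℝ} (h : EqOn a₁ a₂ (Icc (-ℓ) ℓ)) {U F : L2 ℓ}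
    (hU : transportOp ℓ ε a₁ U F) : transportOp ℓ ε a₂ U F := by
  obtain ⟨u, u', u'', hu, hU, hF⟩ := hU
  refine ⟨u, u', u'', hu, hU, ?_⟩
  filter_upwards [hF, ae_restrict_mem measurableSet_Ioo] with x h1 hx
  have hev : (fun y => (a₁ y : ℂ) * u y) =ᶠ[nhds x] (fun y => (a₂ y : ℂ) * u y) :=
    Filter.eventuallyEq_of_mem (Icc_mem_nhds hx.1 hx.2) fun y hy => by
      simp only [h hy]
  rw [h1, hev.deriv_eq]

theorem liouvilleFactor_congr {a₁ a₂ : ℝ → ℝ} (h : EqOn a₁ a₂ (Icc (-ℓ) ℓ)) {x : ℝ}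
    (hx : x ∈ Icc (-ℓ) ℓ) : liouvilleFactor ℓ ε a₁ x = liouvilleFactor ℓ ε a₂ x := by
  unfold liouvilleFactor
  rw [intervalIntegral.integral_congr (g := a₂)]
  intro y hy
  rw [uIcc_of_le hx.1] at hy
  exact h ⟨hy.1, hy.2.trans hx.2⟩

theorem isEigenvalue_transportOp_iff (hℓ : 0 < ℓ) (hε : 0 < ε) (ha : LipschitzWith K a) (z : ℂ) :
    IsEigenvalue (transportOp ℓ ε a) z ↔ IsEigenvalue (schrodingerOp ℓ ε a) ((ε : ℂ) * z) := by
  have hac := ha.continuous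
  have hg := (continuous_expPrimitive (ℓ := ℓ) (-(1 / (2 * ε))) hac).continuousOn
    (s := Icc (-ℓ) ℓ)
  have hgi := (continuous_expPrimitive (ℓ := ℓ) (1 / (2 * ε)) hac).continuousOn
    (s := Icc (-ℓ) ℓ)
  have hscal : ∀ U V : L2 ℓ,
      (V =ᵐ[intervalMeasure ℓ] fun x => (liouvilleFactor ℓ ε a x : ℂ) * U x) →
      (((ε : ℂ) * z) • V : L2 ℓ) =ᵐ[intervalMeasure ℓ]
        fun x => (ε : ℂ) * (liouvilleFactor ℓ ε a x : ℂ) * (z • U : L2 ℓ) x := by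
    intro U V h
    filter_upwards [h, Lp.coeFn_smul ((ε : ℂ) * z) V, Lp.coeFn_smul z U] with x h1 h2 h3
    rw [h2, h3, Pi.smul_apply, Pi.smul_apply, h1]
    simp only [smul_eq_mul]
    ring
  constructor
  · rintro ⟨U, hU, hT⟩
    have hV := mulOp_ae hg U
    refine ⟨mulOp hg U, fun h0 => hU ?_, liouville_to_schrodinger hℓ hε ha hV (hscal _ _ hV) hT⟩
    apply Lp.ext
    rw [h0] at hV
    filter_upwards [hV, Lp.coeFn_zero ℂ 2 (intervalMeasure ℓ)] with x h1 h2
    rw [h2] at h1 ⊢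
    have : (expPrimitive ℓ (-(1 / (2 * ε))) a x : ℂ) ≠ 0 := by
      exact_mod_cast (expPrimitive_pos ℓ (-(1 / (2 * ε))) a x).ne'
    exact (mul_eq_zero.1 h1.symm).resolve_left this
  · rintro ⟨V, hV, hT⟩
    have hU : V =ᵐ[intervalMeasure ℓ]
        fun x => (liouvilleFactor ℓ ε a x : ℂ) * (mulOp hgi V) x := by
      filter_upwards [mulOp_ae hgi V] with x h1
      rw [h1, show liouvilleFactor ℓ ε a x = expPrimitive ℓ (-(1 / (2 * ε))) a x from rfl,
        ← mul_assoc, mul_comm (expPrimitive ℓ (-(1 / (2 * ε))) a x : ℂ),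
        expPrimitive_mul_neg_complex, one_mul]
    refine ⟨mulOp hgi V, fun h0 => hV ?_, liouville_of_schrodinger hℓ hε ha hU (hscal _ _ hU) hT⟩
    apply Lp.ext
    rw [h0] at hU
    filter_upwards [hU, Lp.coeFn_zero ℂ 2 (intervalMeasure ℓ)] with x h1 h2
    rw [h1, h2]
    simp

end Schrodinger

/-! ### The shape of the primitive of `a` and the truncated weight. -/

section TestFunction

variable {ℓ ξ am ap ε ε₀ : ℝ} {K : NNReal} {a : ℝ → ℝ}

theorem measurable_stepFun (ξ am ap : ℝ) : Measurable (stepFun ξ am ap) :=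
  Measurable.ite measurableSet_Iio measurable_const measurable_const

/-- The primitive of the step function is a tent with peak at `ξ` and slopes at least `min am (-ap)`
in modulus; replacing the step by `a` costs at most the `L¹` distance. -/
theorem primitive_sub_le (hξ : ξ ∈ Ioo (-ℓ) ℓ) (ha : Continuous a) {D : ℝ} (hD : 0 ≤ D)
    (hL1 : eLpNorm (fun x => a x - stepFun ξ am ap x) 1 (intervalMeasure ℓ) ≤ ENNReal.ofReal D)
    {x : ℝ} (hx : x ∈ Icc (-ℓ) ℓ) :
    (∫ y in (-ℓ)..x, a y) - ∫ y in (-ℓ)..ξ, a y ≤ -(min am (-ap) * |x - ξ|) + D := by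
  have hℓ : 0 < ℓ := by linarith [hξ.1, hξ.2]
  have hm : MemLp (fun x => a x - stepFun ξ am ap x) 1 (intervalMeasure ℓ) :=
    ⟨(ha.measurable.sub (measurable_stepFun ξ am ap)).aestronglyMeasurable,
      hL1.trans_lt ENNReal.ofReal_lt_top⟩
  have hi : Integrable (fun x => ‖a x - stepFun ξ am ap x‖) (intervalMeasure ℓ) :=
    (memLp_one_iff_integrable.1 hm).norm
  have hint : ∫ x, ‖a x - stepFun ξ am ap x‖ ∂(intervalMeasure ℓ) ≤ D := by
    have h := hm.1
    rw [integral_norm_eq_lintegral_enorm h, ← eLpNorm_one_eq_lintegral_enorm]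
    exact ENNReal.toReal_le_of_le_ofReal hD hL1
  have hsub : ∀ p q, -ℓ ≤ p → p ≤ q → q ≤ ℓ →
      ∫ x in p..q, ‖a x - stepFun ξ am ap x‖ ≤ D := by
    intro p q hp hpq hq
    rw [intervalIntegral.integral_of_le hpq, integral_Ioc_eq_integral_Ioo]
    refine le_trans ?_ hint
    exact setIntegral_mono_set hi (Filter.Eventually.of_forall fun _ => norm_nonneg _)
      (Ioo_subset_Ioo hp hq).eventuallyLE
  have hξ' := Ioo_subset_Icc_self hξ
  have hai : ∀ p q, IntervalIntegrable a volume p q := fun p q => ha.intervalIntegrable p q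
  have hni := intervalIntegrable_of_integrable hℓ hi hξ' hx
  rw [intervalIntegral.integral_interval_sub_left (hai _ _) (hai _ _)]
  rcases le_total ξ x with h | h
  · have h1 : ∫ y in ξ..x, a y ≤ ∫ y in ξ..x, (ap + ‖a y - stepFun ξ am ap y‖) := by
      refine intervalIntegral.integral_mono_on h (hai _ _)
        (intervalIntegrable_const.add hni) fun y hy => ?_
      have : stepFun ξ am ap y = ap := if_neg (not_lt.2 hy.1)
      rw [this]
      linarith [Real.le_norm_self (a y - ap)]
    rw [intervalIntegral.integral_add intervalIntegrable_const hni,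
      intervalIntegral.integral_const, smul_eq_mul] at h1
    have h2 := hsub ξ x hξ'.1 h hx.2
    rw [abs_of_nonneg (sub_nonneg.2 h)]
    nlinarith [min_le_right am (-ap), sub_nonneg.2 h]
  · have h1 : ∫ y in x..ξ, (am - ‖a y - stepFun ξ am ap y‖) ≤ ∫ y in x..ξ, a y := by
      -- The comparison is made on the open interval because at `ξ` itself the step function already
      -- has the value `ap`.
      refine intervalIntegral.integral_mono_on_of_le_Ioo h
        (intervalIntegrable_const.sub hni.symm) (hai _ _) fun y hy => ?_
      have : stepFun ξ am ap y = am := if_pos hy.2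
      rw [this, Real.norm_eq_abs]
      linarith [neg_abs_le (a y - am)]
    rw [intervalIntegral.integral_sub intervalIntegrable_const hni.symm,
      intervalIntegral.integral_const, smul_eq_mul] at h1
    have h2 := hsub x ξ hx.1 h hξ'.2
    rw [intervalIntegral.integral_symm, abs_of_nonpos (sub_nonpos.2 h)]
    nlinarith [min_le_left am (-ap), sub_nonneg.2 h]

theorem abs_primitive_sub_le (hξ : ξ ∈ Ioo (-ℓ) ℓ) (ha : Continuous a) {M : ℝ}
    (hb : ∀ᵐ x ∂(intervalMeasure ℓ), |a x| ≤ M) {x : ℝ} (hx : x ∈ Ioo (-ℓ) ℓ) :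
    |(∫ y in (-ℓ)..x, a y) - ∫ y in (-ℓ)..ξ, a y| ≤ M * |x - ξ| := by
  rw [intervalIntegral.integral_interval_sub_left (ha.intervalIntegrable _ _)
    (ha.intervalIntegrable _ _)]
  have key : ∀ᵐ y, y ∈ uIoc ξ x → ‖a y‖ ≤ M := by
    filter_upwards [(ae_restrict_iff' measurableSet_Ioo).1 hb] with y hy hy2
    rw [uIoc, mem_Ioc] at hy2
    exact hy ⟨lt_of_le_of_lt (le_min hξ.1.le hx.1.le) hy2.1,
      lt_of_le_of_lt hy2.2 (max_lt hξ.2 hx.2)⟩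
  exact intervalIntegral.norm_integral_le_of_norm_le_const_ae key

theorem exists_cutoff {d : ℝ} (hd : 0 < d) (h1 : d ≤ ℓ - ξ) (h2 : d ≤ ξ + ℓ) :
    ∃ (χ χ' χ'' : ℝ → ℝ) (B : ℝ), 0 < B ∧
      IsDirichletH2 ℓ (fun x => (χ x : ℂ)) (fun x => (χ' x : ℂ)) (fun x => (χ'' x : ℂ)) ∧
      Continuous χ' ∧ Continuous χ'' ∧ (∀ x ∈ Icc (-ℓ) ℓ, |χ' x| ≤ B ∧ |χ'' x| ≤ B) ∧
      ∀ x, |x - ξ| < d / 2 → χ x = 1 ∧ χ' x = 0 ∧ χ'' x = 0 := by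
  have hℓ : 0 < ℓ := by linarith
  let χ : ContDiffBump ξ := ⟨d / 2, d, by linarith, by linarith⟩
  have hχ : ContDiff ℝ 2 χ := χ.contDiff
  have hc1 : ContDiff ℝ 1 (deriv χ) := by
    have : ContDiff ℝ (1 + 1) χ := by simpa [one_add_one_eq_two] using hχ
    exact (contDiff_succ_iff_deriv.1 this).2.2
  have hc2 : Continuous (deriv (deriv χ)) := hc1.continuous_deriv le_rfl
  have hd1 : ∀ x, HasDerivAt χ (deriv χ x) x := fun x =>
    (hχ.differentiable (by norm_num) x).hasDerivAt
  have hd2 : ∀ x, HasDerivAt (deriv χ) (deriv (deriv χ) x) x := fun x =>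
    (hc1.differentiable (by norm_num) x).hasDerivAt
  obtain ⟨B1, hB1⟩ := (isCompact_Icc (a := -ℓ) (b := ℓ)).exists_bound_of_continuousOn
    hc1.continuous.continuousOn
  obtain ⟨B2, hB2⟩ := (isCompact_Icc (a := -ℓ) (b := ℓ)).exists_bound_of_continuousOn
    hc2.continuousOn
  refine ⟨χ, deriv χ, deriv (deriv χ), max 1 (max B1 B2), by positivity, ?_, hc1.continuous, hc2,
    fun x hx => ⟨?_, ?_⟩, ?_⟩
  · constructor
    · exact fun x _ => (hd1 x).ofReal_comp.hasDerivWithinAt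
    · exact absolutelyContinuousOnInterval_of_hasDerivWithinAt hℓ
        (fun x _ => (hd2 x).ofReal_comp.hasDerivWithinAt)
        (Complex.continuous_ofReal.comp hc2).continuousOn
    · exact Filter.Eventually.of_forall fun x => (hd2 x).ofReal_comp
    · exact memLp_of_continuousOn (Complex.continuous_ofReal.comp hc2).continuousOn
    · have : χ (-ℓ) = 0 := χ.zero_of_le_dist (by
        rw [Real.dist_eq, abs_sub_comm]
        exact h2.trans (by linarith [le_abs_self (ξ - -ℓ)]))
      simp [this]
    · have : χ ℓ = 0 := χ.zero_of_le_dist (by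
        rw [Real.dist_eq]
        exact h1.trans (le_abs_self _))
      simp [this]
  · exact (hB1 x hx).trans ((le_max_left _ _).trans (le_max_right _ _))
  · exact (hB2 x hx).trans ((le_max_right _ _).trans (le_max_right _ _))
  · have e0 : ∀ x ∈ Metric.ball ξ (d / 2), χ x = 1 := fun x hx =>
      χ.one_of_mem_closedBall (Metric.ball_subset_closedBall hx)
    have e1 : ∀ x ∈ Metric.ball ξ (d / 2), deriv χ x = 0 := fun x hx => by
      have : (χ : ℝ → ℝ) =ᶠ[nhds x] fun _ => 1 :=
        Filter.eventuallyEq_of_mem (Metric.isOpen_ball.mem_nhds hx) e0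
      rw [this.deriv_eq, deriv_const]
    have e2 : ∀ x ∈ Metric.ball ξ (d / 2), deriv (deriv χ) x = 0 := fun x hx => by
      have : deriv χ =ᶠ[nhds x] fun _ => 0 :=
        Filter.eventuallyEq_of_mem (Metric.isOpen_ball.mem_nhds hx) e1
      rw [this.deriv_eq, deriv_const]
    intro x hx
    have hx' : x ∈ Metric.ball ξ (d / 2) := by rwa [Metric.mem_ball, Real.dist_eq]
    exact ⟨e0 x hx', e1 x hx', e2 x hx'⟩

/-- For `V = e^{A/2ε} χ`, the factor `ε d/dx - a/2` gives `ε e^{A/2ε} χ'`, and `ε d/dx + a/2` then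
gives `e^{A/2ε}(ε² χ'' + ε a χ')`: all terms in `χ` itself cancel. -/
theorem exists_schrodingerOp_cutoff (hε : 0 < ε) (hℓ : 0 < ℓ) (ha : LipschitzWith K a)
    {χ χ' χ'' : ℝ → ℝ} (hχ : IsDirichletH2 ℓ (fun x => (χ x : ℂ)) (fun x => (χ' x : ℂ))
      (fun x => (χ'' x : ℂ))) (hχ' : Continuous χ') (hχ'' : Continuous χ'') :
    ∃ V G : L2 ℓ, schrodingerOp ℓ ε a V G ∧
      (∀ᵐ x ∂(intervalMeasure ℓ), ‖V x‖ = expPrimitive ℓ (1 / (2 * ε)) a x * |χ x|) ∧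
      (∀ᵐ x ∂(intervalMeasure ℓ), ‖G x‖ =
        expPrimitive ℓ (1 / (2 * ε)) a x * |ε ^ 2 * χ'' x + ε * (a x * χ' x)|) := by
  have hε' : (ε : ℂ) ≠ 0 := by exact_mod_cast hε.ne'
  have hE := continuous_expPrimitive (ℓ := ℓ) (1 / (2 * ε)) ha.continuous
  have hD := hχ.mul_expPrimitive hℓ (1 / (2 * ε)) ha
  have hV := memLp_of_continuousOn (p := 2) hD.continuousOn
  have hG := memLp_of_continuousOn (p := 2) (ℓ := ℓ)
    (m := fun x => ((expPrimitive ℓ (1 / (2 * ε)) a x : ℝ) : ℂ) *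
      ((ε ^ 2 * χ'' x + ε * (a x * χ' x) : ℝ) : ℂ)) (by
      have := ha.continuous
      exact (hE.mul (Complex.continuous_ofReal.comp (by fun_prop))).continuousOn)
  refine ⟨hV.toLp _, hG.toLp _, ⟨_, _, _, hD, hV.coeFn_toLp, ?_⟩, ?_, ?_⟩
  · filter_upwards [hG.coeFn_toLp] with x h1
    rw [h1, potential]
    push_cast
    field_simp
    ring
  · filter_upwards [hV.coeFn_toLp] with x h1
    rw [h1, norm_mul, Complex.norm_real, Complex.norm_real, Real.norm_eq_abs, Real.norm_eq_abs,
      abs_of_pos (expPrimitive_pos _ _ _ _)]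
  · filter_upwards [hG.coeFn_toLp] with x h1
    rw [h1, norm_mul, Complex.norm_real, Complex.norm_real, Real.norm_eq_abs, Real.norm_eq_abs,
      abs_of_pos (expPrimitive_pos _ _ _ _)]

end TestFunction

/-! ### Exponential smallness of the quasimode error. -/

section Estimate

variable {ℓ ξ am ap ε ε₀ : ℝ} {K : NNReal} {a : ℝ → ℝ}

theorem expPrimitive_le_of_primitive_sub_le (hε : 0 < ε) {x y r : ℝ}
    (h : (∫ t in (-ℓ)..x, a t) - ∫ t in (-ℓ)..y, a t ≤ r) :
    expPrimitive ℓ (1 / (2 * ε)) a x ≤ expPrimitive ℓ (1 / (2 * ε)) a y *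
      Real.exp (r / (2 * ε)) := by
  rw [expPrimitive, expPrimitive, ← Real.exp_add, Real.exp_le_exp]
  have h2 : (1 / (2 * ε)) * ((∫ t in (-ℓ)..x, a t) - ∫ t in (-ℓ)..y, a t) ≤ (1 / (2 * ε)) * r :=
    mul_le_mul_of_nonneg_left h (by positivity)
  rw [div_eq_mul_one_div r]
  linarith

theorem L2.norm_le_of_ae_bound (hℓ : 0 < ℓ) {G : L2 ℓ} {B : ℝ} (hB : 0 ≤ B)
    (h : ∀ᵐ x ∂(intervalMeasure ℓ), ‖G x‖ ≤ B) : ‖G‖ ≤ √(2 * ℓ) * B := by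
  have h1 := Lp.norm_le_of_ae_bound hB h
  have h2 : ((measureUnivNNReal (intervalMeasure ℓ) : NNReal) : ℝ) = 2 * ℓ := by
    rw [measureUnivNNReal, ENNReal.coe_toNNReal_eq_toReal, Measure.restrict_apply_univ,
      Real.volume_Ioo, ENNReal.toReal_ofReal (by linarith)]
    ring
  rw [h2] at h1
  rw [Real.sqrt_eq_rpow]
  convert h1 using 3
  norm_num

theorem L2.le_norm_of_ae_bound {V : L2 ℓ} {x r c : ℝ} (hr : 0 ≤ r) (hc : 0 ≤ c)
    (h1 : -ℓ ≤ x - r) (h2 : x + r ≤ ℓ)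
    (h : ∀ᵐ y ∂(intervalMeasure ℓ), y ∈ Ioo (x - r) (x + r) → c ≤ ‖V y‖) :
    c * √(2 * r) ≤ ‖V‖ := by
  have hfin : intervalMeasure ℓ (Ioo (x - r) (x + r)) ≠ ⊤ := measure_ne_top _ _
  have hle : ‖indicatorConstLp 2 measurableSet_Ioo hfin (c : ℂ)‖ ≤ ‖V‖ := by
    refine Lp.norm_le_norm_of_ae_le ?_
    filter_upwards [h, indicatorConstLp_coeFn (p := 2) (hs := measurableSet_Ioo) (hμs := hfin)
      (c := (c : ℂ))] with y e1 e2
    rw [e2]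
    by_cases hy : y ∈ Ioo (x - r) (x + r)
    · rw [indicator_of_mem hy, Complex.norm_real, Real.norm_eq_abs, abs_of_nonneg hc]
      exact e1 hy
    · rw [indicator_of_notMem hy, norm_zero]
      exact norm_nonneg _
  have hμ : (intervalMeasure ℓ).real (Ioo (x - r) (x + r)) = 2 * r := by
    rw [measureReal_restrict_apply measurableSet_Ioo, inter_eq_left.2 (Ioo_subset_Ioo h1 h2),
      Real.volume_real_Ioo_of_le (by linarith)]
    ring
  rw [norm_indicatorConstLp (by norm_num) (by norm_num), hμ, Complex.norm_real, Real.norm_eq_abs,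
    abs_of_nonneg hc] at hle
  rw [Real.sqrt_eq_rpow]
  convert hle using 3
  norm_num

theorem exp_neg_mul_sqrt_le {t : ℝ} (ht : 0 ≤ t) : Real.exp (-t) * √t ≤ 1 := by
  have h1 : √t ≤ Real.exp t := by
    have h2 := Real.sq_sqrt ht
    nlinarith [Real.add_one_le_exp t, sq_nonneg (√t - 1), Real.sqrt_nonneg t]
  calc Real.exp (-t) * √t ≤ Real.exp (-t) * Real.exp t := by gcongr
    _ = 1 := by rw [← Real.exp_add]; simp

/-- With `φ = e^{A(ξ)/2ε}`, the error lives where `|x - ξ| ≥ d/2`, so it is `O(ε φ e^{-2c/ε})`. On a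
window of width of order `ε` about `ξ` the trial function is at least a constant times `φ`, so its
norm is at least of order `φ √ε`. The factor `φ` cancels in the quotient, and one of the two
exponentials absorbs the loss of `√ε`. -/
theorem exists_quasimode (hξ : ξ ∈ Ioo (-ℓ) ℓ) (ham : 0 < am) (hap : ap < 0) (hε₀ : 0 < ε₀)
    {M₀ M₁ : ℝ} (hM₀ : 0 ≤ M₀) (hM₁ : 0 ≤ M₁) :
    ∃ C c : ℝ, 0 < C ∧ 0 < c ∧ ∀ ε ∈ Ioo 0 ε₀, ∀ (K : NNReal) (a : ℝ → ℝ), LipschitzWith K a →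
      (∀ᵐ x ∂(intervalMeasure ℓ), |a x| ≤ M₀) →
      eLpNorm (fun x => a x - stepFun ξ am ap x) 1 (intervalMeasure ℓ) ≤ ENNReal.ofReal (M₁ * ε) →
      ∃ V G : L2 ℓ, schrodingerOp ℓ ε a V G ∧ V ≠ 0 ∧
        ‖G‖ ≤ ε * (C * Real.exp (-c / ε)) * ‖V‖ := by
  have hℓ : 0 < ℓ := by linarith [hξ.1, hξ.2]
  obtain ⟨d, hd, hd1, hd2⟩ : ∃ d, 0 < d ∧ d ≤ ℓ - ξ ∧ d ≤ ξ + ℓ :=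
    ⟨min (ℓ - ξ) (ξ + ℓ), lt_min (by linarith [hξ.2]) (by linarith [hξ.1]), min_le_left _ _,
      min_le_right _ _⟩
  obtain ⟨χ, χ', χ'', B, hB, hχ, hχ', hχ'', hbd, hone⟩ := exists_cutoff hd hd1 hd2
  set m := min am (-ap) with hm
  have hmpos : 0 < m := lt_min ham (by linarith)
  -- At distance `d/2` the exponent is `-m (d/2) / (2ε) = -2c/ε`; half of it is kept for the final
  -- rate.
  set c := m * d / 8 with hc
  have hcpos : 0 < c := by positivity
  set κ := M₀ * d / (4 * ε₀) with hκ
  set Q := √(c * d / ε₀) with hQ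
  have hQpos : 0 < Q := Real.sqrt_pos.2 (by positivity)
  refine ⟨√(2 * ℓ) * Real.exp (M₁ / 2) * (B * (ε₀ + M₀)) / (Real.exp (-κ) * Q), c, by positivity,
    hcpos, fun ε hε K a ha hb hL1 => ?_⟩
  have hε0 : 0 < ε := hε.1
  obtain ⟨V, G, hVG, hV, hG⟩ := exists_schrodingerOp_cutoff hε0 hℓ ha hχ hχ' hχ''
  set φ := expPrimitive ℓ (1 / (2 * ε)) a ξ with hφ
  have hφpos : 0 < φ := expPrimitive_pos _ _ _ _
  have hGle : ‖G‖ ≤ √(2 * ℓ) * (φ * (Real.exp (M₁ / 2) * Real.exp (-c / ε) * Real.exp (-c / ε)) *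
      (ε * (B * (ε₀ + M₀)))) := by
    refine G.norm_le_of_ae_bound hℓ (by positivity) ?_
    filter_upwards [hG, hb, ae_restrict_mem measurableSet_Ioo] with x h1 h2 hx
    rw [h1]
    rcases lt_or_ge |x - ξ| (d / 2) with h | h
    · obtain ⟨-, e1, e2⟩ := hone x h
      rw [e1, e2]
      simp only [mul_zero, add_zero, abs_zero]
      positivity
    · have hx' := Ioo_subset_Icc_self hx
      have hA := primitive_sub_le hξ ha.continuous (by positivity) hL1 hx'
      have hA' : (∫ y in (-ℓ)..x, a y) - ∫ y in (-ℓ)..ξ, a y ≤ -(m * (d / 2)) + M₁ * ε := by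
        have : m * (d / 2) ≤ m * |x - ξ| := by gcongr
        linarith
      have hE := expPrimitive_le_of_primitive_sub_le hε0 hA'
      have hexp : Real.exp ((-(m * (d / 2)) + M₁ * ε) / (2 * ε)) =
          Real.exp (M₁ / 2) * Real.exp (-c / ε) * Real.exp (-c / ε) := by
        rw [← Real.exp_add, ← Real.exp_add, hc]
        congr 1
        field_simp
        ring
      rw [hexp] at hE
      refine mul_le_mul hE ?_ (abs_nonneg _) (by positivity)
      obtain ⟨b1, b2⟩ := hbd x hx'
      calc |ε ^ 2 * χ'' x + ε * (a x * χ' x)|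
          ≤ |ε ^ 2 * χ'' x| + |ε * (a x * χ' x)| := abs_add_le _ _
        _ = ε * (ε * |χ'' x|) + ε * (|a x| * |χ' x|) := by
          rw [abs_mul, abs_mul, abs_mul, abs_of_pos hε0, abs_of_pos (pow_pos hε0 2)]
          ring
        _ ≤ ε * (ε₀ * B) + ε * (M₀ * B) := by
          have := hε.2.le
          gcongr
        _ = ε * (B * (ε₀ + M₀)) := by ring
  have hVge : φ * Real.exp (-κ) * (Real.exp (-c / ε) * Q) ≤ ‖V‖ := by
    -- Proportional to `ε`, so that `A` varies by at most `M₀ r` on the window and `M₀ r / (2ε) = κ`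
    -- does not depend on `ε`; and `r < d/2` since `ε < ε₀`, so `χ = 1` there.
    set r := ε * d / (2 * ε₀) with hr
    have hr0 : 0 ≤ r := by positivity
    have hrd : r < d / 2 := by
      rw [hr, div_lt_div_iff₀ (by positivity) (by norm_num)]
      nlinarith [mul_lt_mul_of_pos_right hε.2 hd]
    have h1 := L2.le_norm_of_ae_bound (V := V) (x := ξ) (r := r) (c := φ * Real.exp (-κ)) hr0
      (by positivity) (by linarith) (by linarith) (by
        filter_upwards [hV, ae_restrict_mem measurableSet_Ioo] with y e1 hy hyr
        have hyξ : |y - ξ| < r := abs_lt.2 ⟨by linarith [hyr.1], by linarith [hyr.2]⟩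
        rw [e1, (hone y (hyξ.trans hrd)).1, abs_one, mul_one]
        have hA := (abs_le.1 (abs_primitive_sub_le hξ ha.continuous hb hy)).1
        have hA' : (∫ t in (-ℓ)..ξ, a t) - ∫ t in (-ℓ)..y, a t ≤ M₀ * r := by
          have : M₀ * |y - ξ| ≤ M₀ * r := by gcongr
          linarith
        have hE := expPrimitive_le_of_primitive_sub_le hε0 hA'
        have hκ' : M₀ * r / (2 * ε) = κ := by
          rw [hr, hκ]; field_simp; ring
        rw [hκ'] at hE
        calc φ * Real.exp (-κ)
            ≤ expPrimitive ℓ (1 / (2 * ε)) a y * Real.exp κ * Real.exp (-κ) := by gcongr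
          _ = _ := by rw [mul_assoc, ← Real.exp_add]; simp)
    refine le_trans ?_ h1
    gcongr
    -- The spare exponential pays for the shrinking window: `e^{-c/ε} √(c/ε) ≤ 1`, which leaves the
    -- constant `Q` free of `ε`.
    have hsplit : Q = √(c / ε) * √(2 * r) := by
      rw [hQ, ← Real.sqrt_mul (by positivity), hr]
      congr 1
      field_simp
    rw [hsplit, ← mul_assoc]
    have := exp_neg_mul_sqrt_le (t := c / ε) (by positivity)
    rw [← neg_div] at this
    exact mul_le_of_le_one_left (Real.sqrt_nonneg _) this
  refine ⟨V, G, hVG, ?_, hGle.trans ?_⟩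
  · rintro rfl
    rw [norm_zero] at hVge
    exact absurd hVge (not_le.2 (by positivity))
  · refine le_trans (le_of_eq ?_) (mul_le_mul_of_nonneg_left hVge (by positivity))
    field_simp

end Estimate

end DiffusionTransport

end

/-! ### The main theorem. -/

open DiffusionTransport in
theorem proposition4p1
    (ℓ ξ am ap ε₀ C₀ C₁ : ℝ) (hξ : ξ ∈ Set.Ioo (-ℓ) ℓ) (ham : 0 < am) (hap : ap < 0)
    (a : ℝ → ℝ → ℝ)
    (hLip : ∀ ε ∈ Set.Ioo 0 ε₀, ∃ K, LipschitzOnWith K (a ε) (Set.Icc (-ℓ) ℓ))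
    (hA0 : ∀ ε ∈ Set.Ioo 0 ε₀,
      MeasureTheory.eLpNorm (a ε) ⊤ (intervalMeasure ℓ)
        + ENNReal.ofReal ε * MeasureTheory.eLpNorm (deriv (a ε)) ⊤ (intervalMeasure ℓ)
        ≤ ENNReal.ofReal C₀)
    (hL1 : ∀ ε ∈ Set.Ioo 0 ε₀,
      MeasureTheory.eLpNorm (fun x => a ε x - stepFun ξ am ap x) 1 (intervalMeasure ℓ)
        ≤ ENNReal.ofReal (C₁ * ε)) :
    (∀ ε ∈ Set.Ioo 0 ε₀,
      IsSelfAdjointOp (schrodingerOp ℓ ε (a ε)) ∧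
      (∀ U F V G : L2 ℓ,
        (V =ᵐ[intervalMeasure ℓ] fun x => (liouvilleFactor ℓ ε (a ε) x : ℂ) * U x) →
        (G =ᵐ[intervalMeasure ℓ] fun x => (ε : ℂ) * (liouvilleFactor ℓ ε (a ε) x : ℂ) * F x) →
        (transportOp ℓ ε (a ε) U F ↔ schrodingerOp ℓ ε (a ε) V G)) ∧
      (∀ z ∈ opSpectrum (transportOp ℓ ε (a ε)),
        IsEigenvalue (transportOp ℓ ε (a ε)) z ∧ z.im = 0 ∧ z.re < 0)) ∧
    ∃ C c : ℝ, 0 < C ∧ 0 < c ∧ ∀ ε ∈ Set.Ioo 0 ε₀, ∃ lam₁ : ℝ,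
      IsGreatest {lam : ℝ | IsEigenvalue (transportOp ℓ ε (a ε)) (lam : ℂ)} lam₁ ∧
      -C * Real.exp (-c / ε) ≤ lam₁ ∧ lam₁ < 0 := by
  have hℓ : 0 < ℓ := by linarith [hξ.1, hξ.2]
  have hneg : ∀ ε > 0, ∀ (K : NNReal) (b : ℝ → ℝ), LipschitzWith K b → ∀ z : ℂ,
      IsEigenvalue (transportOp ℓ ε b) z → z.im = 0 ∧ z.re < 0 := by
    intro ε hε K b hb z hz
    obtain ⟨S, -, hS⟩ := exists_schrodinger_inverse hℓ hε hb
    have h := eigenvalue_real_neg hS (fun V G => inner_schrodingerOp_nonpos hℓ hb)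
      ((isEigenvalue_transportOp_iff hℓ hε hb z).1 hz)
    simpa [hε.ne', mul_neg_iff, hε, hε.not_gt] using h
  -- Both operators depend only on the coefficient on `[-ℓ, ℓ]`, so a globally Lipschitz extension
  -- `b` gives the same graphs.
  have hext : ∀ ε ∈ Set.Ioo 0 ε₀, ∃ (K : NNReal) (b : ℝ → ℝ), LipschitzWith K b ∧
      Set.EqOn (a ε) b (Set.Icc (-ℓ) ℓ) ∧
      transportOp ℓ ε (a ε) = transportOp ℓ ε b ∧
      schrodingerOp ℓ ε (a ε) = schrodingerOp ℓ ε b := by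
    intro ε hε
    obtain ⟨K, hK⟩ := hLip ε hε
    obtain ⟨b, hb, hab⟩ := hK.extend_real
    exact ⟨K, b, hb, hab,
      funext₂ fun _ _ => propext ⟨transportOp_congr hab, transportOp_congr hab.symm⟩,
      funext₂ fun _ _ => propext ⟨schrodingerOp_congr hab, schrodingerOp_congr hab.symm⟩⟩
  constructor
  · intro ε hε
    obtain ⟨K, b, hb, hab, hT, hS⟩ := hext ε hε
    rw [hT, hS]
    refine ⟨?_, ?_, ?_⟩
    · obtain ⟨S, -, hS⟩ := exists_schrodinger_inverse hℓ hε.1 hb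
      exact isSelfAdjointOp_of_inverse hS (fun V G => inner_schrodingerOp_nonpos hℓ hb)
        fun G => eq_zero_of_schrodingerOp_zero
    · intro U F V G hV hG
      have hg : ∀ᵐ x ∂(intervalMeasure ℓ),
          liouvilleFactor ℓ ε (a ε) x = liouvilleFactor ℓ ε b x := by
        filter_upwards [MeasureTheory.ae_restrict_mem measurableSet_Ioo] with x hx
        exact liouvilleFactor_congr hab (Set.Ioo_subset_Icc_self hx)
      have hV' : V =ᵐ[intervalMeasure ℓ] fun x => (liouvilleFactor ℓ ε b x : ℂ) * U x := by
        filter_upwards [hV, hg] with x h1 h2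
        rw [h1, h2]
      have hG' : G =ᵐ[intervalMeasure ℓ]
          fun x => (ε : ℂ) * (liouvilleFactor ℓ ε b x : ℂ) * F x := by
        filter_upwards [hG, hg] with x h1 h2
        rw [h1, h2]
      exact ⟨liouville_to_schrodinger hℓ hε.1 hb hV' hG',
        liouville_of_schrodinger hℓ hε.1 hb hV' hG'⟩
    · intro z hz
      obtain ⟨R, hRc, hR⟩ := exists_transport_inverse hℓ hε.1 hb
      have hev := isEigenvalue_of_mem_opSpectrum hRc hR hz
      exact ⟨hev, hneg ε hε.1 K b hb z hev⟩
  · rcases le_or_gt ε₀ 0 with h0 | hε₀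
    · exact ⟨1, 1, one_pos, one_pos, fun ε hε => absurd (hε.1.trans hε.2) (not_lt.2 h0)⟩
    -- No sign of `C₀` or `C₁` is assumed; `ENNReal.ofReal` truncates at zero, so passing to the
    -- positive parts preserves the bounds.
    obtain ⟨C, c, hC, hc, hquasi⟩ := exists_quasimode (M₀ := max C₀ 0) (M₁ := max C₁ 0) hξ ham hap
      hε₀ (le_max_right _ _) (le_max_right _ _)
    refine ⟨C, c, hC, hc, fun ε hε => ?_⟩
    obtain ⟨K, b, hb, hab, hT, -⟩ := hext ε hε
    rw [hT]
    have hε0 : 0 < ε := hε.1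
    have habae : ∀ᵐ x ∂(intervalMeasure ℓ), a ε x = b x := by
      filter_upwards [MeasureTheory.ae_restrict_mem measurableSet_Ioo] with x hx
      exact hab (Set.Ioo_subset_Icc_self hx)
    have hbound : ∀ᵐ x ∂(intervalMeasure ℓ), |b x| ≤ max C₀ 0 := by
      have h1 : MeasureTheory.eLpNorm (a ε) ⊤ (intervalMeasure ℓ) ≤ ENNReal.ofReal C₀ :=
        le_self_add.trans (hA0 ε hε)
      rw [MeasureTheory.eLpNorm_exponent_top] at h1
      filter_upwards [MeasureTheory.enorm_ae_le_eLpNormEssSup (a ε) (intervalMeasure ℓ),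
        habae] with x h2 h3
      have h4 := h2.trans h1
      rw [h3, Real.enorm_eq_ofReal_abs, ENNReal.ofReal_le_ofReal_iff'] at h4
      rcases h4 with h4 | h4
      · exact h4.trans (le_max_left _ _)
      · exact h4.trans (le_max_right _ _)
    have hL1b : MeasureTheory.eLpNorm (fun x => b x - stepFun ξ am ap x) 1 (intervalMeasure ℓ)
        ≤ ENNReal.ofReal (max C₁ 0 * ε) := by
      rw [← MeasureTheory.eLpNorm_congr_ae (f := fun x => a ε x - stepFun ξ am ap x)]
      · refine (hL1 ε hε).trans (ENNReal.ofReal_le_ofReal ?_)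
        gcongr
        exact le_max_left _ _
      · filter_upwards [habae] with x h
        rw [h]
    obtain ⟨V, G, hVG, hV0, hle⟩ := hquasi ε hε K b hb hbound hL1b
    have : Nontrivial (L2 ℓ) := ⟨V, 0, hV0⟩
    obtain ⟨S, hSc, hS⟩ := exists_schrodinger_inverse hℓ hε0 hb
    obtain ⟨μ, hμ, hμ0, hμle⟩ := exists_first_eigenvalue hSc hS
      (fun V G => inner_schrodingerOp_nonpos hℓ hb) fun G => eq_zero_of_schrodingerOp_zero
    have hiff : ∀ lam : ℝ, IsEigenvalue (transportOp ℓ ε b) (lam : ℂ) ↔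
        IsEigenvalue (schrodingerOp ℓ ε b) ((ε * lam : ℝ) : ℂ) := fun lam => by
      rw [isEigenvalue_transportOp_iff hℓ hε0 hb, Complex.ofReal_mul]
    refine ⟨μ / ε, ⟨?_, ?_⟩, ?_, div_neg_of_neg_of_pos hμ0 hε0⟩
    · rw [Set.mem_ofPred_eq, hiff, mul_div_cancel₀ _ hε0.ne']
      exact hμ.1
    · intro lam hlam
      rw [le_div_iff₀ hε0, mul_comm]
      exact hμ.2 ((hiff lam).1 hlam)
    · have h1 := le_of_mul_le_mul_right ((hμle V G hVG).trans hle) (norm_pos_iff.2 hV0)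
      rw [le_div_iff₀ hε0]
      linarith
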